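/- Let $(X,\Phi,Y,\Phi^\vee)$ be a reduced root datum with a base $\Pi=\{\alpha_i\}$, such that the coroots generate the cocharacter lattice $Y$; this is the root datum of a simply connected semisimple (for example, almost simple) split algebraic group with maximal torus $T$, $X=X^*(T)$. Let $W$ be its Weyl group, $s_i$ the simple reflections, $\ell$ the length function, and let $\omega_i\in X$ be the fundamental weights, $\langle\omega_i,\alpha_j^\vee\rangle=\delta_{ij}$. Let $\mathbb{Z}[T]=\mathbb{Z}[X]$ and $\mathbb{C}[T]=\mathbb{C}[X]$ be the group rings of $X$, with elements $\exp(\lambda)$, $\lambda\in X$, and $W$-action $w\exp(\lambda)=\exp(w\lambda)$. For $w\in W$ let $I(w)=\{i:\ell(ws_i)<\ell(w)\}$ be its right descent set, $\overline{I(w)}$ the complement of $I(w)$ in $\Pi$, $\omega_J=\sum_{i\in J}\omega_i$ for $J\subseteq\Pi$, and $W_J=\langle s_i : i\in J\rangle$. Let $C'_w=\sum_{y\in W}P_{y,w}(1)\,y\in\mathbb{Z}[W]$, where the $P_{y,w}\in\mathbb{Z}[q]$ are the Kazhdan–Lusztig polynomials: $C'_w$ is the specialization at $v=1$ of the element $v^{-\ell(w)}\sum_y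 P_{y,w}(v^2)T_y$ of the Hecke algebra (with $q=v^2$) which is fixed by the bar involution, with $P_{w,w}=1$ and $\deg P_{y,w}\le(\ell(w)-\ell(y)-1)/2$ whenever $y\neq w$ and $P_{y,w}\ne0$. Define the Kazhdan–Lusztig–Steinberg elements $$f_w=\frac{1}{|W_{I(w)}|}\,C'_w\bigl(\exp(\omega_{\overline{I(w)}})\bigr)\in\mathbb{C}[T],\qquad w\in W.$$ Then every $f_w$ lies in $\mathbb{Z}[T]$, and $\{f_w\}_{w\in W}$ is a basis of $\mathbb{Z}[T]$ as a module over the ring of invariants $\mathbb{Z}[T]^W$. -/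

import Mathlib

noncomputable section

/-! ### Hecke algebra and Kazhdan–Lusztig basis of a group `W` with simple reflections `s : B → W` -/

namespace KazhdanLusztig

open Polynomial LaurentPolynomial

variable {B W : Type*} [Group W] (s : B → W)

/-- The length of `w`: the least number of factors in an expression of `w` as a product of simple
reflections. -/
def length (w : W) : ℕ :=
  sInf {n : ℕ | ∃ l : List B, l.length = n ∧ (l.map s).prod = w}

/-- The defining relations of the Hecke algebra over `ℤ[v, v⁻¹]`, with `q = v ^ 2`: `T_1 = 1`,
`T_x T_y = T_{xy}` if `ℓ(xy) = ℓ(x) + ℓ(y)`, and `T_s ^ 2 = (q - 1) T_s + q` for `s` simple. -/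
inductive HeckeRel : FreeAlgebra ℤ[T;T⁻¹] W → FreeAlgebra ℤ[T;T⁻¹] W → Prop
  | one : HeckeRel (FreeAlgebra.ι ℤ[T;T⁻¹] 1) 1
  | mul (x y : W) (h : length s (x * y) = length s x + length s y) :
      HeckeRel (FreeAlgebra.ι ℤ[T;T⁻¹] x * FreeAlgebra.ι ℤ[T;T⁻¹] y)
        (FreeAlgebra.ι ℤ[T;T⁻¹] (x * y))
  | quadratic (i : B) :
      HeckeRel (FreeAlgebra.ι ℤ[T;T⁻¹] (s i) * FreeAlgebra.ι ℤ[T;T⁻¹] (s i))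
        ((T 2 - 1 : ℤ[T;T⁻¹]) • FreeAlgebra.ι ℤ[T;T⁻¹] (s i) + (T 2 : ℤ[T;T⁻¹]) • 1)

/-- The Hecke algebra of `(W, s)` over `ℤ[v, v⁻¹]`. -/
abbrev HeckeAlgebra : Type _ := RingQuot (HeckeRel s)

/-- The standard generator `T_w`. -/
def stdT (w : W) : HeckeAlgebra s :=
  RingQuot.mkAlgHom ℤ[T;T⁻¹] (HeckeRel s) (FreeAlgebra.ι ℤ[T;T⁻¹] w)

/-- The bar involution: the ring endomorphism with `v ↦ v⁻¹` and `T_w ↦ (T_{w⁻¹})⁻¹`. It is unique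
because `v`, `v⁻¹` and the `T_w` generate the Hecke algebra. -/
def IsBarInvolution (φ : HeckeAlgebra s →+* HeckeAlgebra s) : Prop :=
  (∀ a : ℤ[T;T⁻¹], φ (algebraMap _ _ a) = algebraMap _ _ (LaurentPolynomial.invert a)) ∧
    ∀ w : W, φ (stdT s w) * stdT s w⁻¹ = 1 ∧ stdT s w⁻¹ * φ (stdT s w) = 1

/-- For a family of polynomials `P w y = P_{y,w}` in `q`, the element
`v ^ (-ℓ(w)) * ∑_y P_{y,w}(v ^ 2) T_y` of the Hecke algebra. -/
def heckeElt (P : W → W → ℤ[X]) (w : W) : HeckeAlgebra s :=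
  (T (-(length s w : ℤ)) : ℤ[T;T⁻¹]) •
    ∑ᶠ y : W, (aeval (T 2 : ℤ[T;T⁻¹]) (P w y)) • stdT s y

/-- `P w y = P_{y,w}` is the family of Kazhdan–Lusztig polynomials: `P_{w,w} = 1`, one has
`deg P_{y,w} ≤ (ℓ(w) - ℓ(y) - 1) / 2` whenever `y ≠ w` and `P_{y,w} ≠ 0`, and the elements
`C'_w = v ^ (-ℓ(w)) * ∑_y P_{y,w}(v ^ 2) T_y` are fixed by the bar involution. (These conditions
determine the family, and they imply that `P_{y,w} = 0` unless `y ≤ w` in the Bruhat order.) -/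
def IsKLFamily (P : W → W → ℤ[X]) : Prop :=
  (∀ w, P w w = 1) ∧
  (∀ w y, y ≠ w → P w y ≠ 0 → 2 * (P w y).natDegree + length s y + 1 ≤ length s w) ∧
  ∃ φ : HeckeAlgebra s →+* HeckeAlgebra s, IsBarInvolution s φ ∧
    ∀ w, φ (heckeElt s P w) = heckeElt s P w

open Classical in
/-- The Kazhdan–Lusztig polynomials, `klPoly s w y = P_{y,w}` (`0` if there were none). -/
def klPoly : W → W → ℤ[X] :=
  if h : ∃ P, IsKLFamily s P then h.choose else 0

/-- The Kazhdan–Lusztig element `C'_w = ∑_y P_{y,w}(1) y` of the group ring `ℤ[W]`, that is, the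
element `C'_w` of the Hecke algebra specialized at `v = 1`. -/
def klC' (w : W) : MonoidAlgebra ℤ W :=
  ∑ᶠ y : W, MonoidAlgebra.single y ((klPoly s w y).eval 1)

/-- The right descent set `I(w)`. -/
def rightDescents (w : W) : Set B := {i | length s (w * s i) < length s w}

/-- The standard parabolic subgroup `W_I`. -/
def parabolic (I : Set B) : Subgroup W := Subgroup.closure (s '' I)

end KazhdanLusztig

/-! ### The Kazhdan–Lusztig–Steinberg elements

A root datum is a root pairing over `ℤ`; `X` is the character lattice of the torus `T`, so that
`ℤ[T] = ℤ[X]` and `ℂ[T] = ℂ[X]`, the character of weight `x` being `exp x = single x 1`. -/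

namespace KLSteinberg

open KazhdanLusztig

variable {ι X Y : Type*} [AddCommGroup X] [AddCommGroup Y]

section Weyl

variable (P : RootPairing ι ℤ X Y)

/-- The action of `w` in the Weyl group on `R[X]`, `exp x ↦ exp (w x)`. -/
def weylAct (R : Type*) [CommRing R] (w : P.weylGroup) :
    AddMonoidAlgebra R X →+* AddMonoidAlgebra R X :=
  AddMonoidAlgebra.mapDomainRingHom R (DistribSMul.toAddMonoidHom X w)

/-- The ring of invariants `ℤ[T]^W`. -/
def invariants : Subring (AddMonoidAlgebra ℤ X) where
  carrier := {f | ∀ w : P.weylGroup, weylAct P ℤ w f = f}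
  mul_mem' hf hg w := by rw [map_mul, hf w, hg w]
  one_mem' w := map_one _
  add_mem' hf hg w := by rw [map_add, hf w, hg w]
  zero_mem' w := map_zero _
  neg_mem' hf w := by rw [map_neg, hf w]

/-- The action of the group ring `ℤ[W]` on `ℂ[T]`. -/
def groupRingAct (a : MonoidAlgebra ℤ P.weylGroup) (f : AddMonoidAlgebra ℂ X) :
    AddMonoidAlgebra ℂ X :=
  a.coeff.sum fun y c => c • weylAct P ℂ y f

end Weyl

variable {P : RootPairing ι ℤ X Y} (b : P.Base)

/-- The simple reflections. -/
def simpleReflection (i : b.support) : P.weylGroup :=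
  RootPairing.weylGroup.ofIdx P i

/-- If the coroots generate `Y` (simple connectedness), the simple coroots form a basis of `Y`. -/
def corootBasis (hsc : P.corootSpan ℤ = ⊤) : Module.Basis b.support ℤ Y :=
  Module.Basis.mk b.linearIndepOn_coroot <| by
    have h := b.span_coroot_support
    rw [Set.image_eq_range] at h
    exact (hsc.symm.trans h.symm).le

/-- The fundamental weight `ω_i`, dual to the simple coroots. -/
def fundamentalWeight (hsc : P.corootSpan ℤ = ⊤) (i : b.support) : X :=
  P.toPerfPair.symm ((corootBasis b hsc).coord i)

open Classical in
theorem fundamentalWeight_coroot (hsc : P.corootSpan ℤ = ⊤) (i j : b.support) :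
    P.toLinearMap (fundamentalWeight b hsc i) (P.coroot j) = if i = j then 1 else 0 := by
  have h : P.toPerfPair (fundamentalWeight b hsc i) = (corootBasis b hsc).coord i :=
    LinearEquiv.apply_symm_apply _ _
  have hj : corootBasis b hsc j = P.coroot j := by simp [corootBasis]
  change P.toPerfPair (fundamentalWeight b hsc i) (P.coroot j) = _
  rw [h, ← hj, Module.Basis.coord_apply, Module.Basis.repr_self, Finsupp.single_apply]
  simp [eq_comm]

open Classical in
/-- `ω_I = ∑_{i ∈ I} ω_i`. -/
def weightSum (hsc : P.corootSpan ℤ = ⊤) (I : Set b.support) : X :=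
  ∑ i with i ∈ I, fundamentalWeight b hsc i

/-- The Kazhdan–Lusztig–Steinberg element `f_w = |W_{I(w)}|⁻¹ C'_w (exp ω_J)` of `ℂ[T]`, where
`J` is the complement of the right descent set `I(w)`. -/
def klsElt (hsc : P.corootSpan ℤ = ⊤) (w : P.weylGroup) : AddMonoidAlgebra ℂ X :=
  (Nat.card (parabolic (simpleReflection b) (rightDescents (simpleReflection b) w)) : ℂ)⁻¹ •
    groupRingAct P (klC' (simpleReflection b) w)
      (AddMonoidAlgebra.single
        (weightSum b hsc (rightDescents (simpleReflection b) w)ᶜ) 1)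

end KLSteinberg

end

/-! Attach to a family g_w in ℤ[T] the matrix (x g_w) indexed by x, w in W, and let D be the product
of 1 - exp(-α) over the positive roots. For every family the determinant is divisible by D^{|W|/2}:
left multiplication by s_α pairs the rows, and paired rows agree modulo 1 - exp(-α)
(`weylDenominator_pow_dvd_det`). If the determinant of the f_w is a unit times D^{|W|/2}, it divides
all the others. Cramer's rule then writes every element of ℤ[T] as a combination of the f_w, and
uniqueness of the solution makes the coefficients W-invariant (`exists_basis_of_dvd_det`).

Write λ_w for the dominant weight defining f_w. Its stabilizer is W_{I(w)}, and P_{y,w} is constant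
on the cosets y W_{I(w)}. Dividing by |W_{I(w)}| therefore only replaces a sum over W by a sum over
cosets, which gives integrality (`mapRingHom_integralKLSElt`). The coefficient of exp(λ_w) in x f_w
is P_{x⁻¹,w}(1), a unitriangular matrix up to a permutation of the rows. So the determinant has
coefficient ±1 at exp(μ), where μ = Σ λ_w, and its other terms have smaller height
(`det_orbitMatrix_mem_negSubring`).

Each simple reflection is an ascent of half of W, so μ pairs to |W|/2 with every simple coroot, and
exp(μ) D^{|W|/2} is W-invariant up to sign. So is the determinant. Their quotient has constant term
±1, its other terms have negative height, and its support is W-stable; hence it equals ±1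
(`exists_det_orbitMatrix_eq`).

From Kazhdan–Lusztig theory only unitriangularity and P_{ys,w} = P_{y,w} for ws < w are used. Since
`klPoly` is a chosen family, existence has to be proved too: the bar involution comes from the
universal property of the Hecke algebra, the polynomials from the usual recursion on length, and
independence of the T_w from the regular representation. The Coxeter input is confined to
`IsFoldingSystem`. -/

noncomputable section

/-! ### Length in groups generated by involutions -/

namespace KazhdanLusztig

open Polynomial LaurentPolynomial

variable {B W : Type*} [Group W]

/-- Conditions on a family of generating involutions which characterize Coxeter groups: right
multiplication by a generator changes the length by one, and the folding condition holds. -/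
structure IsFoldingSystem (s : B → W) : Prop where
  mul_self (i : B) : s i * s i = 1
  closure_range : Subgroup.closure (Set.range s) = ⊤
  length_mul (w : W) (i : B) :
    length s (w * s i) = length s w + 1 ∨ length s w = length s (w * s i) + 1
  fold (w : W) (i j : B) :
    (length s w < length s (s i * w) ↔ length s (w * s j) < length s (s i * w * s j)) ∨
      s i * w = w * s j

variable {s : B → W}

theorem length_le_of_prod_eq {l : List B} {w : W} (h : (l.map s).prod = w) :
    length s w ≤ l.length :=
  Nat.sInf_le ⟨l, rfl, h⟩

@[simp]
theorem length_one : length s (1 : W) = 0 :=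
  Nat.le_zero.mp (length_le_of_prod_eq (l := []) rfl)

theorem exists_word_of_closure (hs : ∀ i, s i * s i = 1)
    (hc : Subgroup.closure (Set.range s) = ⊤) (w : W) : ∃ l : List B, (l.map s).prod = w := by
  have hw : w ∈ Subgroup.closure (Set.range s) := hc ▸ Subgroup.mem_top w
  induction hw using Subgroup.closure_induction with
  | mem x hx =>
    obtain ⟨i, rfl⟩ := hx
    exact ⟨[i], by simp⟩
  | one => exact ⟨[], rfl⟩
  | mul x y _ _ hx hy =>
    obtain ⟨l, rfl⟩ := hx
    obtain ⟨l', rfl⟩ := hy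
    exact ⟨l ++ l', by simp⟩
  | inv x _ hx =>
    obtain ⟨l, rfl⟩ := hx
    refine ⟨l.reverse, ?_⟩
    rw [List.map_reverse, List.prod_inv_reverse, List.map_map]
    congr 2
    refine List.map_congr_left fun i _ => ?_
    exact eq_inv_of_mul_eq_one_left (hs i)

theorem exists_reduced_word_of_closure (hs : ∀ i, s i * s i = 1)
    (hc : Subgroup.closure (Set.range s) = ⊤) (w : W) :
    ∃ l : List B, l.length = length s w ∧ (l.map s).prod = w := by
  obtain ⟨l, hl⟩ := exists_word_of_closure hs hc w
  exact Nat.sInf_mem (s := {n : ℕ | ∃ l : List B, l.length = n ∧ (l.map s).prod = w})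
    ⟨l.length, l, rfl, hl⟩

theorem length_inv_of_closure (hs : ∀ i, s i * s i = 1)
    (hc : Subgroup.closure (Set.range s) = ⊤) (w : W) : length s w⁻¹ = length s w := by
  have key (w : W) : length s w⁻¹ ≤ length s w := by
    obtain ⟨l, hl, rfl⟩ := exists_reduced_word_of_closure hs hc w
    rw [← hl, ← List.length_reverse]
    apply length_le_of_prod_eq
    rw [List.map_reverse, List.prod_inv_reverse, List.map_map]
    congr 2
    exact List.map_congr_left fun i _ => eq_inv_of_mul_eq_one_left (hs i)
  exact le_antisymm (key w) (by simpa using key w⁻¹)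

namespace IsFoldingSystem

variable (hs : IsFoldingSystem s)
include hs

theorem exists_reduced_word (w : W) :
    ∃ l : List B, l.length = length s w ∧ (l.map s).prod = w :=
  exists_reduced_word_of_closure hs.mul_self hs.closure_range w

theorem inv_simple (i : B) : (s i)⁻¹ = s i := inv_eq_of_mul_eq_one_left (hs.mul_self i)

theorem length_inv (w : W) : length s w⁻¹ = length s w :=
  length_inv_of_closure hs.mul_self hs.closure_range w

theorem length_simple (i : B) : length s (s i) = 1 := by
  simpa using hs.length_mul 1 i

theorem length_simple_mul (w : W) (i : B) :
    length s (s i * w) = length s w + 1 ∨ length s w = length s (s i * w) + 1 := by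
  have h := hs.length_mul w⁻¹ i
  rwa [← hs.length_inv (s i * w), mul_inv_rev, hs.inv_simple, ← hs.length_inv w]

theorem mul_simple_cancel (w : W) (i : B) : w * s i * s i = w := by
  rw [mul_assoc, hs.mul_self, mul_one]

theorem simple_mul_cancel (w : W) (i : B) : s i * (s i * w) = w := by
  rw [← mul_assoc, hs.mul_self, one_mul]

theorem mul_simple_ne (w : W) (i : B) : w * s i ≠ w := by
  intro h
  have := hs.length_mul w i
  rw [h] at this
  omega

/-- Induction on the length by multiplication with simple reflections on the right. -/
theorem induction_right {p : W → Prop} (one : p 1)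
    (mul : ∀ w i, length s (w * s i) = length s w + 1 → p w → p (w * s i)) (w : W) : p w := by
  obtain ⟨l, hl, rfl⟩ := hs.exists_reduced_word w
  induction l using List.reverseRecOn with
  | nil => exact one
  | append_singleton l i ih =>
    simp only [List.map_append, List.map_cons, List.map_nil, List.prod_append, List.prod_singleton,
      List.length_append, List.length_singleton] at hl ⊢
    have h1 : length s (l.map s).prod ≤ l.length := length_le_of_prod_eq rfl
    have h2 := hs.length_mul (l.map s).prod i
    exact mul _ _ (by omega) (ih (by omega))

end IsFoldingSystem

/-! ### Relations in the Hecke algebra -/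

variable (s)

theorem stdT_one : stdT s 1 = 1 := by
  rw [stdT, RingQuot.mkAlgHom_rel _ HeckeRel.one, map_one]

variable {s}

theorem stdT_mul {x y : W} (h : length s (x * y) = length s x + length s y) :
    stdT s x * stdT s y = stdT s (x * y) := by
  rw [stdT, stdT, stdT, ← map_mul, RingQuot.mkAlgHom_rel _ (HeckeRel.mul x y h)]

variable (s) in
theorem stdT_simple_mul_self (i : B) : stdT s (s i) * stdT s (s i) =
    (T 2 - 1 : ℤ[T;T⁻¹]) • stdT s (s i) + (T 2 : ℤ[T;T⁻¹]) • 1 := by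
  rw [stdT, ← map_mul, RingQuot.mkAlgHom_rel _ (HeckeRel.quadratic i), map_add, map_smul,
    map_smul, map_one]

/-- The universal property of the Hecke algebra, for ring homomorphisms. -/
theorem exists_heckeAlgebra_lift {R : Type*} [Ring R] (g : ℤ[T;T⁻¹] →+* R)
    (hg : ∀ a x, g a * x = x * g a) (t : W → R) (one : t 1 = 1)
    (mul : ∀ x y, length s (x * y) = length s x + length s y → t x * t y = t (x * y))
    (quad : ∀ i, t (s i) * t (s i) = g (T 2 - 1) * t (s i) + g (T 2)) :
    ∃ φ : HeckeAlgebra s →+* R, (∀ a, φ (algebraMap _ _ a) = g a) ∧ ∀ w, φ (stdT s w) = t w := by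
  let _ : Algebra ℤ[T;T⁻¹] R := g.toAlgebra' hg
  let F : FreeAlgebra ℤ[T;T⁻¹] W →ₐ[ℤ[T;T⁻¹]] R := FreeAlgebra.lift ℤ[T;T⁻¹] t
  have hF : ∀ ⦃x y⦄, HeckeRel s x y → F x = F y := by
    intro x y h
    cases h with
    | one => simpa [F] using one
    | mul x y h => simpa [F] using mul x y h
    | quadratic i =>
      simp only [F, map_mul, map_add, map_smul, map_one, FreeAlgebra.lift_ι_apply, quad]
      rw [Algebra.smul_def, Algebra.smul_def, mul_one]
      rfl
  let φ := RingQuot.liftAlgHom ℤ[T;T⁻¹] ⟨F, hF⟩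
  refine ⟨φ.toRingHom, fun a => φ.commutes a, fun w => ?_⟩
  change φ (RingQuot.mkAlgHom _ _ _) = _
  rw [RingQuot.liftAlgHom_mkAlgHom_apply]
  simp [F]

-- The quadratic relation rearranged: T_s⁻¹ = q⁻¹ T_s + (q⁻¹ - 1).
variable (s) in
theorem stdT_simple_mul_inv_formula (i : B) :
    stdT s (s i) * ((T (-2) : ℤ[T;T⁻¹]) • stdT s (s i) + (T (-2) - 1 : ℤ[T;T⁻¹]) • 1) = 1 ∧
    ((T (-2) : ℤ[T;T⁻¹]) • stdT s (s i) + (T (-2) - 1 : ℤ[T;T⁻¹]) • 1) * stdT s (s i) = 1 := by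
  have h1 : (T (-2) * T 2 : ℤ[T;T⁻¹]) = 1 := by rw [← T_add]; simp
  have h2 : (T (-2) * (T 2 - 1) + (T (-2) - 1) : ℤ[T;T⁻¹]) = 0 := by rw [mul_sub, h1]; ring
  have h3 : (T (-2) : ℤ[T;T⁻¹]) • ((T 2 - 1 : ℤ[T;T⁻¹]) • stdT s (s i) + (T 2 : ℤ[T;T⁻¹]) • 1) +
      (T (-2) - 1 : ℤ[T;T⁻¹]) • stdT s (s i) = 1 := by
    rw [smul_add, smul_smul, smul_smul, h1, one_smul, add_right_comm, ← add_smul, h2, zero_smul,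
      zero_add]
  constructor
  · rw [mul_add, mul_smul_comm, mul_smul_comm, mul_one, stdT_simple_mul_self, h3]
  · rw [add_mul, smul_mul_assoc, smul_mul_assoc, one_mul, stdT_simple_mul_self, h3]

variable (hs : IsFoldingSystem s)
include hs

theorem stdT_mul_simple_of_lt {w : W} {i : B} (h : length s w < length s (w * s i)) :
    stdT s w * stdT s (s i) = stdT s (w * s i) := by
  refine stdT_mul ?_
  rw [hs.length_simple]
  have := hs.length_mul w i
  omega

theorem stdT_mul_simple_of_gt {w : W} {i : B} (h : length s (w * s i) < length s w) :
    stdT s w * stdT s (s i) =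
      (T 2 - 1 : ℤ[T;T⁻¹]) • stdT s w + (T 2 : ℤ[T;T⁻¹]) • stdT s (w * s i) := by
  have h1 : stdT s (w * s i) * stdT s (s i) = stdT s w := by
    rw [stdT_mul_simple_of_lt hs (by rwa [hs.mul_simple_cancel]), hs.mul_simple_cancel]
  rw [← h1, mul_assoc, stdT_simple_mul_self, mul_add, mul_smul_comm, mul_smul_comm, mul_one]

theorem isUnit_stdT (w : W) : IsUnit (stdT s w) := by
  induction w using hs.induction_right with
  | one => rw [stdT_one]; exact isUnit_one
  | mul w i h ih =>
    rw [← stdT_mul_simple_of_lt hs (by omega)]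
    obtain ⟨h1, h2⟩ := stdT_simple_mul_inv_formula s i
    exact ih.mul ⟨⟨_, _, h1, h2⟩, rfl⟩

omit hs in
theorem inverse_stdT_simple (i : B) : Ring.inverse (stdT s (s i)) =
    (T (-2) : ℤ[T;T⁻¹]) • stdT s (s i) + (T (-2) - 1 : ℤ[T;T⁻¹]) • 1 := by
  obtain ⟨h1, h2⟩ := stdT_simple_mul_inv_formula s i
  exact Ring.inverse_unit ⟨_, _, h1, h2⟩

/-- The elements (T_{w⁻¹})⁻¹ satisfy the defining relations with v replaced by v⁻¹, so the universal
property applies along the twisted scalar map v ↦ v⁻¹. -/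
theorem exists_isBarInvolution :
    ∃ φ : HeckeAlgebra s →+* HeckeAlgebra s, IsBarInvolution s φ := by
  have hinv (x : W) := isUnit_stdT hs x
  obtain ⟨φ, h1, h2⟩ := exists_heckeAlgebra_lift (s := s)
    ((algebraMap ℤ[T;T⁻¹] (HeckeAlgebra s)).comp
      (LaurentPolynomial.invert (R := ℤ)).toAlgHom.toRingHom)
    (fun a x => Algebra.commutes (LaurentPolynomial.invert a) x) (fun w => Ring.inverse (stdT s w⁻¹))
    (by simp [stdT_one])
    (fun x y h => by
      have h' : length s (y⁻¹ * x⁻¹) = length s y⁻¹ + length s x⁻¹ := by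
        rw [← mul_inv_rev, hs.length_inv, hs.length_inv, hs.length_inv, h, add_comm]
      obtain ⟨u, hu⟩ := hinv x⁻¹
      obtain ⟨v, hv⟩ := hinv y⁻¹
      rw [mul_inv_rev, ← stdT_mul h', ← hu, ← hv, ← Units.val_mul, Ring.inverse_unit,
        Ring.inverse_unit, Ring.inverse_unit, mul_inv_rev, Units.val_mul])
    (fun i => by
      have e : (LaurentPolynomial.invert (R := ℤ)).toAlgHom.toRingHom (T 2 - 1) = T (-2) - 1 := by
        change LaurentPolynomial.invert (T 2 - 1 : ℤ[T;T⁻¹]) = _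
        rw [map_sub, invert_T, map_one]
      have e' : (LaurentPolynomial.invert (R := ℤ)).toAlgHom.toRingHom (T 2) = T (-2) :=
        invert_T _
      rw [hs.inv_simple, RingHom.comp_apply, RingHom.comp_apply, e, e', ← Algebra.smul_def]
      set t := Ring.inverse (stdT s (s i)) with ht
      have h1 : t * stdT s (s i) = 1 := Ring.inverse_mul_cancel _ (hinv _)
      nth_rw 2 [ht]
      rw [inverse_stdT_simple, mul_add, mul_smul_comm, mul_smul_comm, mul_one, h1, add_comm,
        Algebra.algebraMap_eq_smul_one])
  refine ⟨φ, ⟨h1, fun w => ?_⟩⟩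
  rw [h2]
  exact ⟨Ring.inverse_mul_cancel _ (hinv _), Ring.mul_inverse_cancel _ (hinv _)⟩

theorem IsBarInvolution.map_stdT_simple {φ : HeckeAlgebra s →+* HeckeAlgebra s}
    (hφ : IsBarInvolution s φ) (i : B) : φ (stdT s (s i)) =
      (T (-2) : ℤ[T;T⁻¹]) • stdT s (s i) + (T (-2) - 1 : ℤ[T;T⁻¹]) • 1 := by
  have h := (hφ.2 (s i)).1
  rw [hs.inv_simple] at h
  exact left_inv_eq_right_inv h (stdT_simple_mul_inv_formula s i).1

end KazhdanLusztig

end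

noncomputable section

namespace KazhdanLusztig

open Polynomial LaurentPolynomial

variable {B W : Type*} [Group W]

/-! ### The regular representation of the Hecke algebra -/

variable (s : B → W)

open Classical in
/-- Left multiplication by `T_s` in the free module on `W`. -/
def leftOp (i : B) : Module.End ℤ[T;T⁻¹] (W →₀ ℤ[T;T⁻¹]) :=
  Finsupp.linearCombination ℤ[T;T⁻¹] fun w =>
    if length s w < length s (s i * w) then Finsupp.single (s i * w) 1
    else (T 2 - 1 : ℤ[T;T⁻¹]) • Finsupp.single w 1 + (T 2 : ℤ[T;T⁻¹]) • Finsupp.single (s i * w) 1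

open Classical in
/-- Right multiplication by `T_s` in the free module on `W`. -/
def rightOp (i : B) : Module.End ℤ[T;T⁻¹] (W →₀ ℤ[T;T⁻¹]) :=
  Finsupp.linearCombination ℤ[T;T⁻¹] fun w =>
    if length s w < length s (w * s i) then Finsupp.single (w * s i) 1
    else (T 2 - 1 : ℤ[T;T⁻¹]) • Finsupp.single w 1 + (T 2 : ℤ[T;T⁻¹]) • Finsupp.single (w * s i) 1

variable {s}

theorem leftOp_of_lt {i : B} {w : W} (h : length s w < length s (s i * w)) :
    leftOp s i (Finsupp.single w 1) = Finsupp.single (s i * w) 1 := by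
  rw [leftOp, Finsupp.linearCombination_single, one_smul, if_pos h]

theorem leftOp_of_not_lt {i : B} {w : W} (h : ¬ length s w < length s (s i * w)) :
    leftOp s i (Finsupp.single w 1) = (T 2 - 1 : ℤ[T;T⁻¹]) • Finsupp.single w 1 +
      (T 2 : ℤ[T;T⁻¹]) • Finsupp.single (s i * w) 1 := by
  rw [leftOp, Finsupp.linearCombination_single, one_smul, if_neg h]

theorem rightOp_of_lt {i : B} {w : W} (h : length s w < length s (w * s i)) :
    rightOp s i (Finsupp.single w 1) = Finsupp.single (w * s i) 1 := by
  rw [rightOp, Finsupp.linearCombination_single, one_smul, if_pos h]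

theorem rightOp_of_not_lt {i : B} {w : W} (h : ¬ length s w < length s (w * s i)) :
    rightOp s i (Finsupp.single w 1) = (T 2 - 1 : ℤ[T;T⁻¹]) • Finsupp.single w 1 +
      (T 2 : ℤ[T;T⁻¹]) • Finsupp.single (w * s i) 1 := by
  rw [rightOp, Finsupp.linearCombination_single, one_smul, if_neg h]

namespace IsFoldingSystem

variable (hs : IsFoldingSystem s)
include hs

/-- This is what the folding condition is for. Either the two multiplications do not affect each
other's length comparison, or s_i w = w s_j and both operators act on the pair {w, s_i w} in the
same way. -/
theorem leftOp_mul_rightOp (i j : B) : leftOp s i * rightOp s j = rightOp s j * leftOp s i := by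
  refine Finsupp.lhom_ext' fun w => LinearMap.ext_ring ?_
  simp only [LinearMap.comp_apply, Finsupp.lsingle_apply, Module.End.mul_apply]
  have h1 := hs.length_simple_mul w i
  have h2 := hs.length_mul w j
  have h3 := hs.length_simple_mul (w * s j) i
  have h4 := hs.length_mul (s i * w) j
  have e : s i * w * s j = s i * (w * s j) := mul_assoc _ _ _
  rw [e] at h4
  rcases hs.fold w i j with hf | hf
  · rw [e] at hf
    by_cases hi : length s w < length s (s i * w) <;> by_cases hj : length s w < length s (w * s j)
    · rw [leftOp_of_lt hi, rightOp_of_lt hj, leftOp_of_lt (hf.mp hi),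
        rightOp_of_lt (by rw [e]; omega), e]
    · rw [leftOp_of_lt hi, rightOp_of_not_lt hj, map_add, map_smul, map_smul,
        leftOp_of_lt (hf.mp hi), rightOp_of_not_lt (by rw [e]; omega), leftOp_of_lt hi, e]
    · rw [leftOp_of_not_lt hi, rightOp_of_lt hj, map_add, map_smul, map_smul,
        rightOp_of_lt hj, rightOp_of_lt (by rw [e]; omega), leftOp_of_not_lt (by omega), e]
    · rw [leftOp_of_not_lt hi, rightOp_of_not_lt hj, map_add, map_smul, map_smul, map_add,
        map_smul, map_smul, rightOp_of_not_lt hj, rightOp_of_not_lt (by rw [e]; omega),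
        leftOp_of_not_lt hi, leftOp_of_not_lt (by omega), e]
      module
  · have e2 : s i * (w * s j) = w := by rw [← hf, hs.simple_mul_cancel]
    have e3 : w * s j * s j = w := hs.mul_simple_cancel w j
    rw [e2, ← hf] at h3
    by_cases hi : length s w < length s (s i * w)
    · rw [leftOp_of_lt hi, rightOp_of_lt (by rwa [← hf]), hf, leftOp_of_not_lt (by rw [e2, ← hf]; omega),
        rightOp_of_not_lt (by rw [e3, ← hf]; omega), e2, e3]
    · rw [leftOp_of_not_lt hi, rightOp_of_not_lt (by rwa [← hf]), map_add, map_smul, map_smul, map_add,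
        map_smul, map_smul, leftOp_of_not_lt hi, rightOp_of_not_lt (by rwa [← hf]), hf,
        leftOp_of_lt (by rw [e2, ← hf]; omega), rightOp_of_lt (by rw [e3, ← hf]; omega), e2, e3]

/-- The right multiplications carry the basis vector at 1 to every basis vector, so an operator
commuting with them is determined by one value. -/
theorem eq_of_commute_rightOp {a b : Module.End ℤ[T;T⁻¹] (W →₀ ℤ[T;T⁻¹])}
    (ha : ∀ j, Commute a (rightOp s j)) (hb : ∀ j, Commute b (rightOp s j))
    (h : a (Finsupp.single 1 1) = b (Finsupp.single 1 1)) : a = b := by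
  refine Finsupp.lhom_ext' fun w => LinearMap.ext_ring ?_
  simp only [LinearMap.comp_apply, Finsupp.lsingle_apply]
  induction w using hs.induction_right with
  | one => exact h
  | mul w i hw ih =>
    rw [← rightOp_of_lt (by omega), ← Module.End.mul_apply, ← Module.End.mul_apply, (ha i).eq,
      (hb i).eq, Module.End.mul_apply, Module.End.mul_apply, ih]

theorem commute_prod_leftOp (l : List B) (j : B) :
    Commute (l.map (leftOp s)).prod (rightOp s j) := by
  refine Commute.list_prod_left _ _ fun x hx => ?_
  obtain ⟨i, -, rfl⟩ := List.mem_map.mp hx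
  exact hs.leftOp_mul_rightOp i j

theorem prod_leftOp_apply_one (l : List B) (hl : l.length = length s (l.map s).prod) :
    (l.map (leftOp s)).prod (Finsupp.single 1 1) = Finsupp.single (l.map s).prod 1 := by
  induction l with
  | nil => simp
  | cons i l ih =>
    simp only [List.map_cons, List.prod_cons, List.length_cons] at hl ⊢
    have h1 : length s (l.map s).prod ≤ l.length := length_le_of_prod_eq rfl
    have h2 := hs.length_simple_mul (l.map s).prod i
    rw [Module.End.mul_apply, ih (by omega), leftOp_of_lt (by omega)]

/-- The coordinates with respect to the basis `T_w` of the Hecke algebra. -/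
theorem exists_coordinates : ∃ c : HeckeAlgebra s →ₗ[ℤ[T;T⁻¹]] (W →₀ ℤ[T;T⁻¹]),
    ∀ w, c (stdT s w) = Finsupp.single w 1 := by
  -- The choice of reduced words is harmless: products of left operators commute with the right
  -- ones, so relations between them can be checked at the vector 1. This takes the place of
  -- Matsumoto's theorem.
  choose red hred hprod using hs.exists_reduced_word
  have hone (w : W) : ((red w).map (leftOp s)).prod (Finsupp.single 1 1) = Finsupp.single w 1 := by
    rw [hs.prod_leftOp_apply_one _ (by rw [hred, hprod]), hprod]
  have hcomm (w : W) := hs.commute_prod_leftOp (red w)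
  have hsimple (i : B) : ((red (s i)).map (leftOp s)).prod = leftOp s i := by
    refine hs.eq_of_commute_rightOp (hcomm _) (hs.leftOp_mul_rightOp i) ?_
    rw [hone, leftOp_of_lt (by rw [mul_one, hs.length_simple, length_one]; omega), mul_one]
  obtain ⟨φ, h1, h2⟩ := exists_heckeAlgebra_lift (s := s)
    (algebraMap ℤ[T;T⁻¹] (Module.End ℤ[T;T⁻¹] (W →₀ ℤ[T;T⁻¹])))
    (fun a x => Algebra.commutes a x) (fun w => ((red w).map (leftOp s)).prod)
    (by
      have := hred 1
      rw [length_one, List.length_eq_zero_iff] at this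
      simp [this])
    (fun x y h => by
      refine hs.eq_of_commute_rightOp (fun j => (hcomm x j).mul_left (hcomm y j)) (hcomm _) ?_
      rw [hone, ← List.prod_append, ← List.map_append, hs.prod_leftOp_apply_one]
      · simp [hprod]
      · simp [hprod, hred, h])
    (fun i => by
      rw [hsimple, ← Algebra.smul_def, Algebra.algebraMap_eq_smul_one]
      have hl := hs.leftOp_mul_rightOp i
      have e : s i * s i = 1 := hs.mul_self i
      refine hs.eq_of_commute_rightOp (fun j => (Commute.mul_left (hl j) (hl j)))
        (fun j => (Commute.add_left (Commute.smul_left (hl j) _)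
          (Commute.smul_left (Commute.one_left _) _))) ?_
      rw [Module.End.mul_apply, leftOp_of_lt (by rw [mul_one, hs.length_simple, length_one]; omega),
        mul_one, leftOp_of_not_lt (by rw [e, hs.length_simple, length_one]; omega), e,
        LinearMap.add_apply, LinearMap.smul_apply, LinearMap.smul_apply, Module.End.one_apply,
        leftOp_of_lt (by rw [mul_one, hs.length_simple, length_one]; omega), mul_one])
  -- The coordinates of x are obtained by letting x act on the vector at 1.
  refine ⟨{ toFun := fun x => φ x (Finsupp.single 1 1), map_add' := ?_, map_smul' := ?_ }, ?_⟩
  · intro x y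
    rw [map_add, LinearMap.add_apply]
  · intro a x
    rw [Algebra.smul_def, map_mul, h1, Module.End.mul_apply, Module.algebraMap_end_apply]
    rfl
  · intro w
    change φ (stdT s w) (Finsupp.single 1 1) = _
    rw [h2, hone]

/-! ### Triangularity of the bar involution -/

theorem mul_simple_mem_span {n : ℕ} {x : HeckeAlgebra s} (i : B)
    (hx : x ∈ Submodule.span ℤ[T;T⁻¹] (stdT s '' {y | length s y < n})) :
    x * stdT s (s i) ∈ Submodule.span ℤ[T;T⁻¹] (stdT s '' {y | length s y < n + 1}) := by
  induction hx using Submodule.span_induction with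
  | mem x hx =>
    obtain ⟨y, hy, rfl⟩ := hx
    rw [Set.mem_ofPred_eq] at hy
    have := hs.length_mul y i
    by_cases h : length s y < length s (y * s i)
    · rw [stdT_mul_simple_of_lt hs h]
      exact Submodule.subset_span ⟨_, by rw [Set.mem_ofPred_eq]; omega, rfl⟩
    · rw [stdT_mul_simple_of_gt hs (by omega)]
      exact Submodule.add_mem _
        (Submodule.smul_mem _ _ <|
          Submodule.subset_span ⟨_, by rw [Set.mem_ofPred_eq]; omega, rfl⟩)
        (Submodule.smul_mem _ _ <|
          Submodule.subset_span ⟨_, by rw [Set.mem_ofPred_eq]; omega, rfl⟩)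
  | zero => rw [zero_mul]; exact Submodule.zero_mem _
  | add x y _ _ hx hy => rw [add_mul]; exact Submodule.add_mem _ hx hy
  | smul a x _ hx => rw [smul_mul_assoc]; exact Submodule.smul_mem _ _ hx

/-- Each simple factor contributes q⁻¹ T_s + (q⁻¹ - 1) to the image; only the product of the first
summands reaches length ℓ(w). -/
theorem exists_bar_stdT_eq {φ : HeckeAlgebra s →+* HeckeAlgebra s}
    (hφ : IsBarInvolution s φ) (w : W) :
    ∃ x ∈ Submodule.span ℤ[T;T⁻¹] (stdT s '' {y | length s y < length s w}),
      φ (stdT s w) = (T (-(2 * length s w : ℤ)) : ℤ[T;T⁻¹]) • stdT s w + x := by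
  induction w using hs.induction_right with
  | one => exact ⟨0, Submodule.zero_mem _, by simp [stdT_one]⟩
  | mul w i hw ih =>
    obtain ⟨x, hx, ih⟩ := ih
    have hlt : length s w < length s (w * s i) := by omega
    have hT : (T (-(2 * length s (w * s i) : ℤ)) : ℤ[T;T⁻¹]) =
        T (-2) * T (-(2 * length s w : ℤ)) := by
      rw [← T_add, hw]; congr 1; push_cast; ring
    have hmono : Submodule.span ℤ[T;T⁻¹] (stdT s '' {y | length s y < length s w}) ≤
        Submodule.span ℤ[T;T⁻¹] (stdT s '' {y | length s y < length s (w * s i)}) :=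
      Submodule.span_mono (Set.image_mono fun y hy => lt_trans hy hlt)
    refine ⟨(T (-2) : ℤ[T;T⁻¹]) • (x * stdT s (s i)) + (T (-2) - 1 : ℤ[T;T⁻¹]) • x +
        ((T (-2) - 1) * T (-(2 * length s w : ℤ)) : ℤ[T;T⁻¹]) • stdT s w,
      Submodule.add_mem _ (Submodule.add_mem _ (Submodule.smul_mem _ _ ?_)
        (Submodule.smul_mem _ _ (hmono hx))) (Submodule.smul_mem _ _ ?_), ?_⟩
    · rw [hw]
      exact hs.mul_simple_mem_span i hx
    · exact Submodule.subset_span ⟨w, hlt, rfl⟩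
    · rw [← stdT_mul_simple_of_lt hs hlt, map_mul, hφ.map_stdT_simple hs, ih, hT]
      simp only [mul_add, add_mul, mul_smul_comm, smul_mul_assoc, mul_one, smul_add, smul_smul]
      module

end IsFoldingSystem

end KazhdanLusztig

end

noncomputable section

namespace KazhdanLusztig

open Polynomial LaurentPolynomial

variable {B W : Type*} [Group W]

/-! ### Coordinates of bar-conjugates -/

theorem aeval_T_two_monomial (n : ℕ) (a : ℤ) :
    aeval (T 2 : ℤ[T;T⁻¹]) (monomial n a) = AddMonoidAlgebra.single (2 * n : ℤ) a := by
  rw [aeval_monomial, T_pow, mul_comm (n : ℤ), ← LaurentPolynomial.C_eq_algebraMap, ← single_eq_C_mul_T]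

theorem coeff_aeval_T_two (p : ℤ[X]) (n : ℕ) :
    (aeval (T 2 : ℤ[T;T⁻¹]) p).coeff (2 * n : ℤ) = p.coeff n := by
  induction p using Polynomial.induction_on' with
  | add p q hp hq => rw [map_add, AddMonoidAlgebra.coeff_add, Finsupp.add_apply, hp, hq, coeff_add]
  | monomial m a =>
    rw [aeval_T_two_monomial, AddMonoidAlgebra.coeff_single, Finsupp.single_apply, coeff_monomial]
    simp

theorem exists_of_coeff_aeval_T_two_ne_zero {p : ℤ[X]} {k : ℤ}
    (h : (aeval (T 2 : ℤ[T;T⁻¹]) p).coeff k ≠ 0) : ∃ n : ℕ, k = 2 * n ∧ p.coeff n ≠ 0 := by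
  suffices ∃ n : ℕ, k = 2 * n by
    obtain ⟨n, rfl⟩ := this
    exact ⟨n, rfl, by rwa [coeff_aeval_T_two] at h⟩
  contrapose! h
  induction p using Polynomial.induction_on' with
  | add p q hp hq => rw [map_add, AddMonoidAlgebra.coeff_add, Finsupp.add_apply, hp, hq, add_zero]
  | monomial m a =>
    rw [aeval_T_two_monomial, AddMonoidAlgebra.coeff_single, Finsupp.single_apply,
      if_neg (h m).symm]

variable {s : B → W}

theorem IsBarInvolution.map_smul {φ : HeckeAlgebra s →+* HeckeAlgebra s}
    (hφ : IsBarInvolution s φ) (a : ℤ[T;T⁻¹]) (x : HeckeAlgebra s) :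
    φ (a • x) = LaurentPolynomial.invert a • φ x := by
  rw [Algebra.smul_def, map_mul, hφ.1, ← Algebra.smul_def]

theorem coordinates_eq_zero_of_mem_span {c : HeckeAlgebra s →ₗ[ℤ[T;T⁻¹]] (W →₀ ℤ[T;T⁻¹])}
    (hc : ∀ w, c (stdT s w) = Finsupp.single w 1) {n : ℕ} {x : HeckeAlgebra s}
    (hx : x ∈ Submodule.span ℤ[T;T⁻¹] (stdT s '' {y | length s y < n})) {y : W}
    (hy : n ≤ length s y) : c x y = 0 := by
  classical
  induction hx using Submodule.span_induction with
  | mem x hx =>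
    obtain ⟨z, hz, rfl⟩ := hx
    rw [Set.mem_ofPred_eq] at hz
    rw [hc, Finsupp.single_apply, if_neg]
    rintro rfl
    omega
  | zero => simp
  | add x x' _ _ h h' => rw [map_add, Finsupp.add_apply, h, h', add_zero]
  | smul a x _ h => rw [_root_.map_smul, Finsupp.smul_apply, h, smul_zero]

/-- By triangularity, no T_z with z ≠ y and ℓ(z) ≤ ℓ(y) contributes to the coordinate at y after
applying bar. -/
theorem IsFoldingSystem.coordinates_bar [Fintype W] (hs : IsFoldingSystem s)
    {φ : HeckeAlgebra s →+* HeckeAlgebra s} (hφ : IsBarInvolution s φ)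
    {c : HeckeAlgebra s →ₗ[ℤ[T;T⁻¹]] (W →₀ ℤ[T;T⁻¹])}
    (hc : ∀ w, c (stdT s w) = Finsupp.single w 1) (a : W → ℤ[T;T⁻¹]) {y : W}
    (ha : ∀ z, a z ≠ 0 → length s z ≤ length s y) :
    c (φ (∑ z, a z • stdT s z)) y =
      LaurentPolynomial.invert (a y) * T (-(2 * length s y : ℤ)) := by
  classical
  rw [map_sum, map_sum, Finsupp.finsetSum_apply, Finset.sum_eq_single y]
  · obtain ⟨x, hx, h⟩ := hs.exists_bar_stdT_eq hφ y
    rw [hφ.map_smul, _root_.map_smul, h, map_add, _root_.map_smul, hc, Finsupp.smul_apply,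
      Finsupp.add_apply, coordinates_eq_zero_of_mem_span hc hx le_rfl, add_zero,
      Finsupp.smul_apply, Finsupp.single_eq_same, smul_eq_mul, smul_eq_mul, mul_one]
  · intro z _ hz
    by_cases h0 : a z = 0
    · simp [h0]
    obtain ⟨x, hx, h⟩ := hs.exists_bar_stdT_eq hφ z
    rw [hφ.map_smul, _root_.map_smul, h, map_add, _root_.map_smul, hc, Finsupp.smul_apply,
      Finsupp.add_apply, coordinates_eq_zero_of_mem_span hc hx (ha z h0), add_zero,
      Finsupp.smul_apply, Finsupp.single_apply, if_neg hz, smul_zero, smul_zero]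
  · simp

/-! ### Kazhdan–Lusztig families -/

/-- The conditions on the polynomials `P_{y,w}` with `w` fixed. -/
structure IsKLColumn [Fintype W] (s : B → W) (φ : HeckeAlgebra s →+* HeckeAlgebra s) (w : W)
    (p : W → ℤ[X]) : Prop where
  self : p w = 1
  degree (y : W) (n : ℕ) (hy : y ≠ w) (hn : (p y).coeff n ≠ 0) :
    2 * n + length s y + 1 ≤ length s w
  bar : φ ((T (-(length s w : ℤ)) : ℤ[T;T⁻¹]) •
      ∑ y, (aeval (T 2 : ℤ[T;T⁻¹]) (p y)) • stdT s y) =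
    (T (-(length s w : ℤ)) : ℤ[T;T⁻¹]) • ∑ y, (aeval (T 2 : ℤ[T;T⁻¹]) (p y)) • stdT s y

theorem isKLColumn_of_isKLFamily [Fintype W] {P : W → W → ℤ[X]} (hP : IsKLFamily s P) :
    ∃ φ, IsBarInvolution s φ ∧ ∀ w, IsKLColumn s φ w (P w) := by
  obtain ⟨h1, h2, φ, hφ, h3⟩ := hP
  refine ⟨φ, hφ, fun w => ⟨h1 w, fun y n hy hn => ?_, ?_⟩⟩
  · have h := h2 w y hy (fun h => hn (by rw [h, coeff_zero]))
    have := le_natDegree_of_ne_zero hn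
    omega
  · simpa only [heckeElt, finsum_eq_sum_of_fintype] using h3 w

theorem isKLFamily_of_isKLColumn [Fintype W] {P : W → W → ℤ[X]}
    {φ : HeckeAlgebra s →+* HeckeAlgebra s} (hφ : IsBarInvolution s φ)
    (h : ∀ w, IsKLColumn s φ w (P w)) : IsKLFamily s P := by
  refine ⟨fun w => (h w).self, fun w y hy h0 => (h w).degree y _ hy ?_, φ, hφ, fun w => ?_⟩
  · rw [coeff_natDegree]
    exact leadingCoeff_ne_zero.mpr h0
  · simpa only [heckeElt, finsum_eq_sum_of_fintype] using (h w).bar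

theorem IsKLColumn.eq_zero_of_length_le [Fintype W] {φ : HeckeAlgebra s →+* HeckeAlgebra s} {w : W}
    {p : W → ℤ[X]} (h : IsKLColumn s φ w p) {y : W} (hy : y ≠ w)
    (hl : length s w ≤ length s y) : p y = 0 := by
  by_contra h0
  obtain ⟨n, hn⟩ : ∃ n, (p y).coeff n ≠ 0 := by
    by_contra! h1
    exact h0 (Polynomial.ext h1)
  have := h.degree y n hy hn
  omega

namespace IsFoldingSystem

variable (hs : IsFoldingSystem s)
include hs

theorem sum_smul_stdT_mul_simple [Fintype W] (a : W → ℤ[T;T⁻¹]) (i : B) :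
    (∑ y, a y • stdT s y) * stdT s (s i) = ∑ y, (if length s y < length s (y * s i) then
      (T 2 : ℤ[T;T⁻¹]) * a (y * s i) else a (y * s i) + (T 2 - 1) * a y) • stdT s y := by
  classical
  let e : W ≃ W := Equiv.mulRight (s i)
  have he (y : W) : e y = y * s i := rfl
  have h1 : (∑ y, a y • stdT s y) * stdT s (s i) =
      ∑ y, ((if length s y < length s (y * s i) then 0 else (T 2 - 1) * a y) • stdT s y +
        (if length s y < length s (y * s i) then a y else T 2 * a y) • stdT s (y * s i)) := by
    rw [Finset.sum_mul]
    refine Finset.sum_congr rfl fun y _ => ?_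
    have := hs.length_mul y i
    rw [smul_mul_assoc]
    split_ifs with h
    · rw [stdT_mul_simple_of_lt hs h, zero_smul, zero_add]
    · rw [stdT_mul_simple_of_gt hs (by omega)]
      module
  rw [h1, Finset.sum_add_distrib, ← e.sum_comp (fun y => (if length s y < length s (y * s i) then
      a y else T 2 * a y) • stdT s (y * s i)), ← Finset.sum_add_distrib]
  refine Finset.sum_congr rfl fun y _ => ?_
  have := hs.length_mul y i
  rw [he, hs.mul_simple_cancel]
  by_cases h : length s y < length s (y * s i)
  · rw [if_pos h, if_neg (by omega), if_pos h, zero_smul, zero_add]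
  · rw [if_neg h, if_pos (by omega), if_neg h]
    module

/-- `P_{ys,w} = P_{y,w}` if `ws < w`. -/
theorem klColumn_mul_simple [Fintype W] {φ : HeckeAlgebra s →+* HeckeAlgebra s}
    (hφ : IsBarInvolution s φ) {w : W} {p : W → ℤ[X]} (hp : IsKLColumn s φ w p) {i : B}
    (hi : length s (w * s i) < length s w) (y : W) : p (y * s i) = p y := by
  classical
  suffices key : ∀ y, length s (y * s i) < length s y → p (y * s i) - p y = 0 by
    rcases hs.length_mul y i with h | h
    · have := key (y * s i) (by rw [hs.mul_simple_cancel]; omega)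
      rw [hs.mul_simple_cancel] at this
      exact (sub_eq_zero.mp this).symm
    · exact sub_eq_zero.mp (key y (by omega))
  obtain ⟨c, hc⟩ := hs.exists_coordinates
  -- These are the coefficients of (∑ P_{y,w} T_y)(T_s - q), whose vanishing is the claim.
  let a : W → ℤ[T;T⁻¹] := fun y => if length s y < length s (y * s i) then
    T 2 * aeval (T 2) (p (y * s i) - p y) else aeval (T 2) (p (y * s i) - p y)
  set C : HeckeAlgebra s := (T (-(length s w : ℤ)) : ℤ[T;T⁻¹]) •
    ∑ y, (aeval (T 2 : ℤ[T;T⁻¹]) (p y)) • stdT s y with hC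
  set D : HeckeAlgebra s := ∑ y, a y • stdT s y with hD
  have hd : D = (∑ y, (aeval (T 2 : ℤ[T;T⁻¹]) (p y)) • stdT s y) * stdT s (s i) +
      (-T 2 : ℤ[T;T⁻¹]) • ∑ y, (aeval (T 2 : ℤ[T;T⁻¹]) (p y)) • stdT s y := by
    rw [hs.sum_smul_stdT_mul_simple, Finset.smul_sum, ← Finset.sum_add_distrib]
    refine Finset.sum_congr rfl fun y _ => ?_
    rw [smul_smul, ← add_smul]
    congr 1
    simp only [a, map_sub]
    split_ifs <;> ring
  have hCD : C * stdT s (s i) + (-T 2 : ℤ[T;T⁻¹]) • C = (T (-(length s w : ℤ)) : ℤ[T;T⁻¹]) • D := by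
    rw [hd, hC, smul_add, smul_mul_assoc, smul_comm]
  have hCbar : φ C = C := hp.bar
  clear_value C
  have hTT : (T 2 * T (-2) : ℤ[T;T⁻¹]) = 1 := by rw [← T_add]; simp
  -- Bar multiplies T_s - q by q⁻¹ and fixes C'_w; removing the factor v^{-ℓ(w)} from C'_w accounts
  -- for the rest of the exponent.
  have hbar : φ D = (T (-(2 * length s w : ℤ) - 2) : ℤ[T;T⁻¹]) • D := by
    have hDC : D = (T (length s w : ℤ) : ℤ[T;T⁻¹]) • (C * stdT s (s i) + (-T 2 : ℤ[T;T⁻¹]) • C) := by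
      rw [hCD, smul_smul, ← T_add, add_neg_cancel, T_zero, one_smul]
    have h1 : φ (C * stdT s (s i) + (-T 2 : ℤ[T;T⁻¹]) • C) =
        (T (-2) : ℤ[T;T⁻¹]) • (C * stdT s (s i) + (-T 2 : ℤ[T;T⁻¹]) • C) := by
      rw [map_add, map_mul, hφ.map_smul, hCbar, hφ.map_stdT_simple hs, map_neg, invert_T, mul_add,
        mul_smul_comm, mul_smul_comm, mul_one, smul_add, smul_smul, mul_neg, mul_comm, hTT]
      module
    rw [hDC, hφ.map_smul, h1, invert_T]
    generalize C * stdT s (s i) + (-T 2 : ℤ[T;T⁻¹]) • C = x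
    rw [smul_smul, smul_smul, ← T_add, ← T_add]
    congr 2
    ring
  by_contra! hne
  obtain ⟨y₀, hy₀, hne₀⟩ := hne
  obtain ⟨y, hy, hmax⟩ := Finset.exists_max_image
    {y : W | length s (y * s i) < length s y ∧ p (y * s i) - p y ≠ 0} (length s)
    ⟨y₀, by simpa using ⟨hy₀, hne₀⟩⟩
  simp only [Finset.mem_filter, Finset.mem_univ, true_and] at hy hmax
  have hmax' : ∀ z, a z ≠ 0 → length s z ≤ length s y := by
    intro z hz
    simp only [a] at hz
    split_ifs at hz with h
    · have h0 : p (z * s i * s i) - p (z * s i) ≠ 0 := by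
        rw [hs.mul_simple_cancel]
        intro h0
        rw [← neg_sub, h0] at hz
        simp at hz
      have := hmax (z * s i) ⟨by rwa [hs.mul_simple_cancel], h0⟩
      omega
    · have := hs.length_mul z i
      exact hmax z ⟨by omega, fun h0 => hz (by rw [h0, map_zero])⟩
  have h1 := hs.coordinates_bar hφ hc a hmax'
  have hcD : c D y = a y := by
    simp only [hD, map_sum, _root_.map_smul, hc, Finsupp.finsetSum_apply, Finsupp.smul_apply,
      Finsupp.single_apply, smul_eq_mul, mul_ite, mul_one, mul_zero, Finset.sum_ite_eq',
      Finset.mem_univ, if_true]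
  rw [← hD, hbar, _root_.map_smul, Finsupp.smul_apply, hcD, smul_eq_mul] at h1
  have hay : a y = aeval (T 2 : ℤ[T;T⁻¹]) (p (y * s i) - p y) := if_neg (by omega)
  -- The bound is one weaker than for p y itself, because y s_i is shorter than y by one.
  have hdeg : ∀ n, (p (y * s i) - p y).coeff n ≠ 0 → 2 * n + length s y ≤ length s w := by
    intro n hn
    have hl := hs.length_mul y i
    have hor : (p (y * s i)).coeff n ≠ 0 ∨ (p y).coeff n ≠ 0 := by
      by_contra! h
      exact hn (by rw [coeff_sub, h.1, h.2, sub_zero])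
    rcases hor with h | h
    · have := hp.degree _ n (by rintro rfl; rw [hs.mul_simple_cancel] at hi; omega) h
      omega
    · rcases eq_or_ne y w with rfl | hyw
      · rw [hp.self, coeff_one] at h
        have : n = 0 := by by_contra h'; exact h (if_neg h')
        omega
      · have := hp.degree y n hyw h
        omega
  obtain ⟨n, hn⟩ : ∃ n, (p (y * s i) - p y).coeff n ≠ 0 := by
    by_contra! h
    exact hy.2 (Polynomial.ext h)
  -- The equation at y matches the degree n with a degree m such that m + n = ℓ(w) - ℓ(y) + 1, while
  -- `hdeg` for m and n gives m + n ≤ ℓ(w) - ℓ(y).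
  have h2 := congrArg (fun f : ℤ[T;T⁻¹] => f.coeff (-(2 * n : ℤ) + -(2 * length s y : ℤ))) h1
  rw [hay] at h2
  have hn' : (aeval (T 2 : ℤ[T;T⁻¹]) (p (y * s i) - p y)).coeff (2 * n : ℤ) ≠ 0 := by
    rwa [coeff_aeval_T_two]
  generalize hf : aeval (T 2 : ℤ[T;T⁻¹]) (p (y * s i) - p y) = f at h2 hn'
  simp only [T, AddMonoidAlgebra.coeff_single_mul_apply, AddMonoidAlgebra.coeff_mul_single_apply,
    one_mul, mul_one, LaurentPolynomial.invert_apply] at h2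
  rw [show -(-(2 * n : ℤ) + -(2 * length s y : ℤ) + - -(2 * length s y : ℤ)) = 2 * n by ring] at h2
  rw [← h2, ← hf] at hn'
  obtain ⟨m, hm, hm'⟩ := exists_of_coeff_aeval_T_two_ne_zero hn'
  have h3 := hdeg n hn
  have h4 := hdeg m hm'
  omega

end IsFoldingSystem

end KazhdanLusztig

end

noncomputable section

namespace KazhdanLusztig

open Polynomial LaurentPolynomial

variable {B W : Type*} [Group W] {s : B → W}

/-! ### Existence of the Kazhdan–Lusztig polynomials and their invariance under right descents -/

namespace IsFoldingSystem

variable (hs : IsFoldingSystem s)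
include hs

theorem exists_descent {w : W} (hw : w ≠ 1) : ∃ i, length s (w * s i) < length s w := by
  induction w using hs.induction_right with
  | one => exact absurd rfl hw
  | mul w i h _ => exact ⟨i, by rw [hs.mul_simple_cancel, h]; omega⟩

/-- The inductive construction of the Kazhdan–Lusztig polynomials `P_{y,us}`, `us > u`. -/
theorem isKLColumn_mul_simple [Fintype W] {φ : HeckeAlgebra s →+* HeckeAlgebra s}
    (hφ : IsBarInvolution s φ) {u : W} {i : B} (hi : length s u < length s (u * s i))
    {p : W → ℤ[X]} (hp : IsKLColumn s φ u p) (q : W → W → ℤ[X])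
    (hq : ∀ z, length s z < length s u → IsKLColumn s φ z (q z)) :
    ∃ p', IsKLColumn s φ (u * s i) p' := by
  classical
  -- The coefficient μ(z,u) of P_{z,u} in the largest degree the bound allows, kept only for zs < z.
  -- The exponent `e z` makes v^{-ℓ(us)} q^{e z} equal to v^{-ℓ(z)}.
  let μ : W → ℤ := fun z => if length s (z * s i) < length s z ∧ length s z < length s u ∧
    Odd (length s u - length s z) then (p z).coeff ((length s u - length s z - 1) / 2) else 0
  let e : W → ℕ := fun z => (length s u + 1 - length s z) / 2
  have hμ : ∀ z, μ z ≠ 0 → length s (z * s i) < length s z ∧ length s z < length s u ∧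
      2 * e z + length s z = length s u + 1 := by
    intro z hz
    simp only [μ] at hz
    split_ifs at hz with h
    · obtain ⟨h1, h2, k, h3⟩ := h
      exact ⟨h1, h2, by simp only [e]; omega⟩
    · exact absurd rfl hz
  have hw : length s (u * s i) = length s u + 1 := by
    have := hs.length_mul u i
    omega
  have hpw : p (u * s i) = 0 := hp.eq_zero_of_length_le (hs.mul_simple_ne u i) hi.le
  -- The coefficients of C'_u C'_s - ∑ μ(z,u) C'_z, where C'_s = v⁻¹(T_s + 1).
  refine ⟨fun y => (if length s y < length s (y * s i) then p y + X * p (y * s i)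
    else p (y * s i) + X * p y) - ∑ z, μ z • (X ^ e z * q z y), ?_, ?_, ?_⟩
  · rw [if_neg (by rw [hs.mul_simple_cancel]; omega), hs.mul_simple_cancel, hp.self, hpw, mul_zero,
      add_zero, Finset.sum_eq_zero, sub_zero]
    intro z _
    by_cases h : μ z = 0
    · rw [h, zero_smul]
    · obtain ⟨-, h1, -⟩ := hμ z h
      rw [(hq z h1).eq_zero_of_length_le (by rintro rfl; omega) (by omega), mul_zero, smul_zero]
  · intro y n hy hn
    by_contra! hlt
    rw [hw] at hlt
    refine hn ?_
    have hus : y * s i ≠ u := by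
      rintro rfl
      exact hy (hs.mul_simple_cancel y i).symm
    have hpdeg : ∀ z m, z ≠ u → length s u < 2 * m + length s z + 1 → (p z).coeff m = 0 := by
      intro z m hz h
      by_contra h'
      have := hp.degree z m hz h'
      omega
    have hly := hs.length_mul y i
    have hsum : (∑ z, μ z • (X ^ e z * q z y)).coeff n = if n = e y then μ y else 0 := by
      rw [finsetSum_coeff, Finset.sum_eq_single y]
      · by_cases h : μ y = 0
        · simp [h]
        · rw [(hq y (hμ y h).2.1).self, mul_one, coeff_smul, coeff_X_pow, smul_eq_mul, mul_ite,
            mul_one, mul_zero]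
      · intro z _ hz
        by_cases h : μ z = 0
        · simp [h]
        obtain ⟨h1, h2, h3⟩ := hμ z h
        rw [coeff_smul, coeff_X_pow_mul']
        split_ifs with h4
        · by_cases h5 : (q z y).coeff (n - e z) = 0
          · rw [h5, smul_zero]
          · have := (hq z h2).degree y _ hz.symm h5
            omega
        · exact smul_zero _
      · simp
    rw [coeff_sub, hsum]
    split_ifs with h1 h2 h2
    · have : μ y = 0 := by
        by_contra h
        have := (hμ y h).1
        omega
      rw [this, sub_zero, coeff_add]
      have hp1 : (p y).coeff n = 0 := by
        rcases eq_or_ne y u with rfl | hyu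
        · rw [hp.self, coeff_one, if_neg (by omega)]
        · exact hpdeg y n hyu (by omega)
      rw [hp1, zero_add]
      cases n with
      | zero => simp
      | succ n => rw [coeff_X_mul, hpdeg _ n hus (by omega)]
    · rw [sub_zero, coeff_add]
      have hp1 : (p y).coeff n = 0 := by
        rcases eq_or_ne y u with rfl | hyu
        · rw [hp.self, coeff_one, if_neg (by omega)]
        · exact hpdeg y n hyu (by omega)
      rw [hp1, zero_add]
      cases n with
      | zero => simp
      | succ n => rw [coeff_X_mul, hpdeg _ n hus (by omega)]
    -- The only place where the degree bound is in danger: for ys < y the term X * p y can reach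
    -- degree `e y`, and its coefficient there is exactly the `μ y` being subtracted.
    · have hyu : y ≠ u := by
        rintro rfl
        exact h1 hi
      rw [coeff_add, hpdeg _ n hus (by omega), zero_add, sub_eq_zero]
      simp only [e] at h2
      cases n with
      | zero =>
        rw [mul_coeff_zero, coeff_X_zero, zero_mul]
        by_contra h
        have := (hμ y (Ne.symm h)).2
        omega
      | succ n =>
        rw [coeff_X_mul]
        simp only [μ]
        split_ifs with h3
        · congr 1
          omega
        · by_contra h
          refine h (hpdeg y n hyu ?_)
          by_contra h4
          refine h3 ⟨by omega, by omega, ?_⟩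
          rw [Nat.odd_iff]
          omega
    · have hyu : y ≠ u := by
        rintro rfl
        exact h1 hi
      rw [coeff_add, hpdeg _ n hus (by omega), zero_add, sub_zero]
      simp only [e] at h2
      cases n with
      | zero => simp
      | succ n => rw [coeff_X_mul, hpdeg _ n hyu (by omega)]
  · let S : (W → ℤ[X]) → HeckeAlgebra s := fun p =>
      ∑ y, (aeval (T 2 : ℤ[T;T⁻¹]) (p y)) • stdT s y
    have hsum : S (fun y => (if length s y < length s (y * s i) then p y + X * p (y * s i)
        else p (y * s i) + X * p y) - ∑ z, μ z • (X ^ e z * q z y)) +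
        ∑ z, ((μ z : ℤ[T;T⁻¹]) * T (2 * e z)) • S (q z) = S p * stdT s (s i) + S p := by
      simp only [S]
      rw [hs.sum_smul_stdT_mul_simple]
      simp only [Finset.smul_sum, smul_smul]
      rw [Finset.sum_comm (f := fun z y => (((μ z : ℤ[T;T⁻¹]) * T (2 * e z)) *
        aeval (T 2 : ℤ[T;T⁻¹]) (q z y)) • stdT s y), ← Finset.sum_add_distrib,
        ← Finset.sum_add_distrib]
      refine Finset.sum_congr rfl fun y _ => ?_
      rw [map_sub, map_sum, ← add_smul]
      simp only [zsmul_eq_mul, map_mul, map_pow, map_intCast, aeval_X, T_pow]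
      rw [← Finset.sum_smul, ← add_smul]
      congr 1
      simp only [mul_comm _ (2 : ℤ), ← mul_assoc, sub_add_cancel]
      split_ifs
      · rw [map_add, map_mul, aeval_X]; ring
      · rw [map_add, map_mul, aeval_X]; ring
    have hTw : (T (-(length s (u * s i) : ℤ)) : ℤ[T;T⁻¹]) = T (-1) * T (-(length s u : ℤ)) := by
      rw [← T_add, hw]
      congr 1
      push_cast
      ring
    have hCz : ∀ z, (T (-(length s (u * s i) : ℤ)) : ℤ[T;T⁻¹]) •
        (((μ z : ℤ[T;T⁻¹]) * T (2 * e z)) • S (q z)) =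
        (μ z : ℤ[T;T⁻¹]) • ((T (-(length s z : ℤ)) : ℤ[T;T⁻¹]) • S (q z)) := by
      intro z
      by_cases h : μ z = 0
      · simp [h]
      · obtain ⟨-, -, h3⟩ := hμ z h
        rw [smul_smul, smul_smul, mul_left_comm, ← T_add, hw]
        congr 3
        push_cast
        omega
    have hCz' : ∀ z, φ ((μ z : ℤ[T;T⁻¹]) • ((T (-(length s z : ℤ)) : ℤ[T;T⁻¹]) • S (q z))) =
        (μ z : ℤ[T;T⁻¹]) • ((T (-(length s z : ℤ)) : ℤ[T;T⁻¹]) • S (q z)) := by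
      intro z
      by_cases h : μ z = 0
      · simp [h]
      · rw [hφ.map_smul, map_intCast, (hq z (hμ z h).2.1).bar]
    have hCu : φ ((T (-(length s u : ℤ)) : ℤ[T;T⁻¹]) • S p) =
        (T (-(length s u : ℤ)) : ℤ[T;T⁻¹]) • S p := hp.bar
    -- This element is the product of the bar-invariant elements C'_u and v⁻¹(T_s + 1).
    have hfix : φ ((T (-(length s (u * s i) : ℤ)) : ℤ[T;T⁻¹]) • (S p * stdT s (s i) + S p)) =
        (T (-(length s (u * s i) : ℤ)) : ℤ[T;T⁻¹]) • (S p * stdT s (s i) + S p) := by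
      have h1 : (T (-(length s (u * s i) : ℤ)) : ℤ[T;T⁻¹]) • (S p * stdT s (s i) + S p) =
          (T (-1) : ℤ[T;T⁻¹]) • (((T (-(length s u : ℤ)) : ℤ[T;T⁻¹]) • S p) * stdT s (s i) +
            (T (-(length s u : ℤ)) : ℤ[T;T⁻¹]) • S p) := by
        rw [hTw, smul_mul_assoc, ← smul_add, smul_smul]
      have hT1 : (T 1 * T (-2) : ℤ[T;T⁻¹]) = T (-1) := by
        rw [← T_add]
        congr 1
      rw [h1, hφ.map_smul, map_add, map_mul, hCu, invert_T, neg_neg, hφ.map_stdT_simple hs]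
      generalize (T (-(length s u : ℤ)) : ℤ[T;T⁻¹]) • S p = x
      rw [mul_add, mul_smul_comm, mul_smul_comm, mul_one, ← hT1, mul_smul]
      module
    change φ (_ • S _) = _ • S _
    have hS : ∀ x y z : HeckeAlgebra s, x + y = z → x = z + (-1 : ℤ[T;T⁻¹]) • y := by
      rintro x y _ rfl
      have : y + (-1 : ℤ[T;T⁻¹]) • y = 0 := by module
      rw [add_assoc, this, add_zero]
    rw [hS _ _ _ hsum, smul_add, smul_comm, Finset.smul_sum, map_add, hfix, hφ.map_smul, map_sum,
      map_neg, map_one]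
    congr 2
    refine Finset.sum_congr rfl fun z _ => ?_
    rw [hCz, hCz']

theorem exists_isKLColumn [Fintype W] {φ : HeckeAlgebra s →+* HeckeAlgebra s}
    (hφ : IsBarInvolution s φ) (w : W) : ∃ p, IsKLColumn s φ w p := by
  classical
  induction h : length s w using Nat.strong_induction_on generalizing w with
  | _ n ih =>
    rcases eq_or_ne w 1 with rfl | hw
    · refine ⟨fun y => if y = 1 then 1 else 0, if_pos rfl, fun y n hy hn => ?_, ?_⟩
      · simp [hy] at hn
      · have : (∑ y, (aeval (T 2 : ℤ[T;T⁻¹]) (if y = 1 then 1 else 0 : ℤ[X])) • stdT s y) = 1 := by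
          rw [Finset.sum_eq_single 1]
          · simp [stdT_one]
          · intro y _ hy
            simp [hy]
          · simp
        rw [this]
        simp
    · obtain ⟨i, hi⟩ := hs.exists_descent hw
      obtain ⟨p, hp⟩ := ih _ (h ▸ hi) (w * s i) rfl
      have : ∀ z, ∃ q, length s z < length s (w * s i) → IsKLColumn s φ z q := by
        intro z
        by_cases hz : length s z < length s (w * s i)
        · obtain ⟨q, hq⟩ := ih _ (by omega) z rfl
          exact ⟨q, fun _ => hq⟩
        · exact ⟨0, fun h => absurd h hz⟩
      choose q hq using this
      have hcancel := hs.mul_simple_cancel w i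
      obtain ⟨p', hp'⟩ := hs.isKLColumn_mul_simple hφ (u := w * s i) (i := i)
        (by rwa [hcancel]) hp q hq
      rw [hcancel] at hp'
      exact ⟨p', hp'⟩

/-- Existence rules out the default value 0 of `klPoly`. Uniqueness is not needed, since later
arguments use only the defining properties of the chosen family. -/
theorem isKLFamily_klPoly [Finite W] : IsKLFamily s (klPoly s) := by
  have := Fintype.ofFinite W
  have h : ∃ P, IsKLFamily s P := by
    obtain ⟨φ, hφ⟩ := exists_isBarInvolution hs
    choose P hP using hs.exists_isKLColumn hφ
    exact ⟨P, isKLFamily_of_isKLColumn hφ hP⟩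
  rw [klPoly, dif_pos h]
  exact h.choose_spec

theorem klPoly_self [Finite W] (w : W) : klPoly s w w = 1 := hs.isKLFamily_klPoly.1 w

theorem klPoly_eq_zero [Finite W] {y w : W} (hy : y ≠ w) (hl : length s w ≤ length s y) :
    klPoly s w y = 0 := by
  have := Fintype.ofFinite W
  obtain ⟨φ, -, h⟩ := isKLColumn_of_isKLFamily hs.isKLFamily_klPoly
  exact (h w).eq_zero_of_length_le hy hl

theorem klPoly_mul_simple [Finite W] {w : W} {i : B} (hi : i ∈ rightDescents s w) (y : W) :
    klPoly s w (y * s i) = klPoly s w y := by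
  have := Fintype.ofFinite W
  obtain ⟨φ, hφ, h⟩ := isKLColumn_of_isKLFamily hs.isKLFamily_klPoly
  exact hs.klColumn_mul_simple hφ (h w) hi y

theorem klPoly_mul_of_mem_parabolic [Finite W] {w z : W}
    (hz : z ∈ parabolic s (rightDescents s w)) (y : W) :
    klPoly s w (y * z) = klPoly s w y := by
  induction hz using Subgroup.closure_induction generalizing y with
  | mem x hx =>
    obtain ⟨i, hi, rfl⟩ := hx
    exact hs.klPoly_mul_simple hi y
  | one => rw [mul_one]
  | mul a b _ _ ha hb => rw [← mul_assoc, hb, ha]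
  | inv a _ ha => rw [← ha (y * a⁻¹), inv_mul_cancel_right]

end IsFoldingSystem

end KazhdanLusztig

end

noncomputable section

namespace KLSteinberg

open KazhdanLusztig

variable {ι X Y : Type*} [AddCommGroup X] [AddCommGroup Y]

/-! ### The Weyl group acting on weights and on root indices -/

section Action

variable {P : RootPairing ι ℤ X Y}

theorem isAddTorsionFree_weight (P : RootPairing ι ℤ X Y) : IsAddTorsionFree X :=
  have : Module.IsReflexive ℤ X := .of_isPerfPair P.toLinearMap
  .of_isTorsionFree ℤ X

theorem isReduced_flip [Finite ι] [P.IsReduced] : P.flip.IsReduced :=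
  have : Module.IsReflexive ℤ X := .of_isPerfPair P.toLinearMap
  have : Module.IsReflexive ℤ Y := .of_isPerfPair P.flip.toLinearMap
  inferInstance

theorem root_weylGroup_smul (g : P.weylGroup) (i : ι) : P.root (g • i) = g • P.root i :=
  (P.weylGroup_apply_root g i).symm

theorem ofIdx_smul_idx (i j : ι) : RootPairing.weylGroup.ofIdx P i • j = P.reflectionPerm i j := rfl

theorem ofIdx_smul_weight (i : ι) (x : X) : RootPairing.weylGroup.ofIdx P i • x =
    x - P.toLinearMap x (P.coroot i) • P.root i := by
  rw [RootPairing.weylGroup.ofIdx_smul, RootPairing.Equiv.reflection_smul,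
    RootPairing.reflection_apply]
  rfl

theorem toLinearMap_smul_coroot_smul (g : P.weylGroup) (x : X) (i : ι) :
    P.toLinearMap (g • x) (P.coroot (g • i)) = P.toLinearMap x (P.coroot i) := by
  have h := LinearMap.congr_fun (RootPairing.Hom.weight_coweight_transpose_apply P P
    (P.coroot (g • i)) g.1.toHom) x
  have h' : g.1.toHom.indexEquiv.symm (g • i) = i := g.1.toHom.indexEquiv.symm_apply_apply i
  rw [RootPairing.Hom.coroot_coweightMap_apply P P, h'] at h
  exact h

theorem toLinearMap_smul_coroot (g : P.weylGroup) (x : X) (i : ι) :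
    P.toLinearMap (g • x) (P.coroot i) = P.toLinearMap x (P.coroot (g⁻¹ • i)) := by
  rw [← toLinearMap_smul_coroot_smul g x (g⁻¹ • i), smul_inv_smul]

theorem weylGroup_eq_of_smul_weight_eq {g g' : P.weylGroup} (h : ∀ x : X, g • x = g' • x) :
    g = g' :=
  Subtype.ext (RootPairing.Equiv.weightHom_injective P (LinearEquiv.ext h))

theorem ofIdx_mul_self (i : ι) :
    RootPairing.weylGroup.ofIdx P i * RootPairing.weylGroup.ofIdx P i = 1 := by
  refine weylGroup_eq_of_smul_weight_eq fun x => ?_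
  rw [mul_smul, one_smul, RootPairing.weylGroup.ofIdx_smul, RootPairing.weylGroup.ofIdx_smul,
    RootPairing.Equiv.reflection_smul, RootPairing.Equiv.reflection_smul,
    RootPairing.reflection_same]

theorem ofIdx_smul (g : P.weylGroup) (i : ι) : RootPairing.weylGroup.ofIdx P (g • i) * g =
    g * RootPairing.weylGroup.ofIdx P i := by
  refine weylGroup_eq_of_smul_weight_eq fun x => ?_
  rw [mul_smul, mul_smul, ofIdx_smul_weight, ofIdx_smul_weight, toLinearMap_smul_coroot_smul,
    root_weylGroup_smul, smul_sub, smul_comm g]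

/-- Here and below, `P.reflectionPerm i i` is the index of the negative of the root i. -/
theorem ofIdx_reflectionPerm_self (i : ι) : RootPairing.weylGroup.ofIdx P (P.reflectionPerm i i) =
    RootPairing.weylGroup.ofIdx P i := by
  rw [← ofIdx_smul_idx, ← mul_left_inj (RootPairing.weylGroup.ofIdx P i), ofIdx_smul]

end Action

/-! ### Positive roots, lengths and dominant weights -/

section Base

variable {P : RootPairing ι ℤ X Y} (b : P.Base)

theorem isPos_reflectionPerm_self_iff (i : ι) :
    b.IsPos (P.reflectionPerm i i) ↔ ¬ b.IsPos i :=
  RootPairing.Base.IsPos.neg_iff_not b i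

theorem reflectionPerm_self_self (i : ι) :
    P.reflectionPerm (P.reflectionPerm i i) (P.reflectionPerm i i) = i := by
  let := P.indexNeg
  exact neg_neg i

theorem simpleReflection_smul_idx (i : b.support) (j : ι) :
    simpleReflection b i • j = P.reflectionPerm i j := rfl

theorem simpleReflection_mul_self (i : b.support) :
    simpleReflection b i * simpleReflection b i = 1 := ofIdx_mul_self _

theorem simpleReflection_smul_weight (i : b.support) (x : X) : simpleReflection b i • x =
    x - P.toLinearMap x (P.coroot i) • P.root i := ofIdx_smul_weight _ _

variable [Finite ι] [P.IsReduced]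

theorem isPos_reflectionPerm_iff {i j : ι} (hj : j ∈ b.support) (hij : i ≠ j)
    (hij' : P.reflectionPerm i i ≠ j) : b.IsPos (P.reflectionPerm j i) ↔ b.IsPos i := by
  refine ⟨fun h => ?_, fun h => h.reflectionPerm hj hij⟩
  have h2 : b.IsPos (P.reflectionPerm j (P.reflectionPerm j i)) := by
    refine h.reflectionPerm hj fun h' => hij' ?_
    have : i = P.reflectionPerm j j := by
      nth_rw 2 [← h']
      rw [P.reflectionPerm_self]
    rw [this, reflectionPerm_self_self]
  rwa [P.reflectionPerm_self] at h2

/-- Dominance is tested on coroots, positivity on roots. The two notions of positivity agree on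
simple indices and change in the same way under negation and simple reflections, which reach every
index. -/
theorem isPos_flip_iff (i : ι) : b.flip.IsPos i ↔ b.IsPos i := by
  have := isReduced_flip (P := P)
  refine b.induction_reflect i (p := fun i => b.flip.IsPos i ↔ b.IsPos i) ?_ ?_ ?_
  · intro i hi
    have h := isPos_reflectionPerm_self_iff b.flip i
    rw [isPos_reflectionPerm_self_iff, ← hi]
    exact h
  · intro i hi
    exact iff_of_true (b.flip.isPos_of_mem_support hi) (b.isPos_of_mem_support hi)
  · intro i j hi hj
    by_cases hij : i = j
    · subst hij
      have h := isPos_reflectionPerm_self_iff b.flip i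
      rw [isPos_reflectionPerm_self_iff, ← hi]
      exact h
    by_cases hij' : P.reflectionPerm i i = j
    · have h1 : P.reflectionPerm j i = j := by
        have h2 : i = P.reflectionPerm j j := by rw [← hij', reflectionPerm_self_self]
        rw [h2, P.reflectionPerm_self]
      rw [h1]
      exact iff_of_true (b.flip.isPos_of_mem_support hj) (b.isPos_of_mem_support hj)
    · rw [isPos_reflectionPerm_iff b hj hij hij', ← hi]
      exact isPos_reflectionPerm_iff b.flip hj hij hij'

/-- Dominant weights. -/
def IsDominant (x : X) : Prop := ∀ i ∈ b.support, 0 ≤ P.toLinearMap x (P.coroot i)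

variable {b}

theorem IsDominant.nonneg {x : X} (hx : IsDominant b x) {i : ι} (hi : b.IsPos i) :
    0 ≤ P.toLinearMap x (P.coroot i) := by
  have hi' := (isPos_flip_iff b i).mpr hi
  obtain ⟨f, -, h | h⟩ := b.flip.exists_root_eq_sum_nat_or_neg i
  · change P.coroot i = ∑ j ∈ b.support, f j • P.coroot j at h
    rw [h, map_sum]
    refine Finset.sum_nonneg fun j hj => ?_
    rw [map_nsmul]
    exact nsmul_nonneg (hx j hj) _
  · exfalso
    have h' : P.flip.root i = ∑ j ∈ b.flip.support, (-f j : ℤ) • P.flip.root j := by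
      rw [h, ← Finset.sum_neg_distrib]
      refine Finset.sum_congr rfl fun j _ => ?_
      rw [neg_smul, natCast_zsmul]
    rw [RootPairing.Base.isPos_iff, RootPairing.Base.height_eq_sum (f := fun j => (-f j : ℤ)) h'] at hi'
    have : ∑ j ∈ b.flip.support, (-f j : ℤ) ≤ 0 := Finset.sum_nonpos fun j _ => by simp
    omega

variable (b)

theorem closure_range_simpleReflection : Subgroup.closure (Set.range (simpleReflection b)) = ⊤ := by
  have key (i : ι) : RootPairing.weylGroup.ofIdx P i ∈
      Subgroup.closure (Set.range (simpleReflection b)) := by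
    refine b.induction_reflect i (p := fun i => RootPairing.weylGroup.ofIdx P i ∈
      Subgroup.closure (Set.range (simpleReflection b))) ?_ ?_ ?_
    · intro i hi
      rwa [ofIdx_reflectionPerm_self]
    · intro i hi
      exact Subgroup.subset_closure ⟨⟨i, hi⟩, rfl⟩
    · intro i j hi hj
      have h1 : RootPairing.weylGroup.ofIdx P j ∈
        Subgroup.closure (Set.range (simpleReflection b)) := Subgroup.subset_closure ⟨⟨j, hj⟩, rfl⟩
      rw [← ofIdx_smul_idx, eq_mul_inv_of_mul_eq (ofIdx_smul _ _)]
      exact mul_mem (mul_mem h1 hi) (inv_mem h1)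
  rw [eq_top_iff]
  rintro ⟨g, hg⟩ -
  induction hg using RootPairing.weylGroup.induction with
  | mem i => exact key i
  | one => exact one_mem _
  | mul x y hx hy h1 h2 => exact mul_mem h1 h2

/-- Apply the letters to α_j from the right. At the letter s_i that first makes the root negative,
that root was α_i, so s_i can be deleted at the cost of s_j on the right. -/
theorem exists_exchange (l : List b.support) (j : b.support)
    (h : ¬ b.IsPos ((l.map (simpleReflection b)).prod • (j : ι))) :
    ∃ l' : List b.support, l'.length + 1 = l.length ∧ (l'.map (simpleReflection b)).prod =
      (l.map (simpleReflection b)).prod * simpleReflection b j := by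
  induction l with
  | nil => exact absurd (b.isPos_of_mem_support j.2) (by simpa using h)
  | cons i l ih =>
    simp only [List.map_cons, List.prod_cons] at h ⊢
    by_cases hl : b.IsPos ((l.map (simpleReflection b)).prod • (j : ι))
    · refine ⟨l, rfl, ?_⟩
      have h1 : (l.map (simpleReflection b)).prod • (j : ι) = i := by
        by_contra h2
        exact h (by rw [mul_smul]; exact hl.reflectionPerm i.2 h2)
      have h2 := ofIdx_smul (l.map (simpleReflection b)).prod (j : ι)
      rw [h1] at h2
      change simpleReflection b i * _ = _ * simpleReflection b j at h2
      rw [mul_assoc, ← h2, ← mul_assoc, simpleReflection_mul_self, one_mul]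
    · obtain ⟨l', h1, h2⟩ := ih hl
      exact ⟨i :: l', by simp [h1], by simp [h2, mul_assoc]⟩

theorem length_mul_simpleReflection_of_not_isPos {w : P.weylGroup} {j : b.support}
    (h : ¬ b.IsPos (w • (j : ι))) :
    length (simpleReflection b) w = length (simpleReflection b) (w * simpleReflection b j) + 1 := by
  obtain ⟨l, hl, rfl⟩ := exists_reduced_word_of_closure (simpleReflection_mul_self b)
    (closure_range_simpleReflection b) w
  obtain ⟨l', h1, h2⟩ := exists_exchange b l j h
  have h3 := length_le_of_prod_eq h2
  obtain ⟨l₂, h4, h5⟩ := exists_reduced_word_of_closure (simpleReflection_mul_self b)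
    (closure_range_simpleReflection b) ((l.map (simpleReflection b)).prod * simpleReflection b j)
  have h6 : length (simpleReflection b) (l.map (simpleReflection b)).prod ≤ (l₂ ++ [j]).length := by
    refine length_le_of_prod_eq ?_
    rw [List.map_append, List.prod_append, h5, List.map_singleton, List.prod_singleton, mul_assoc,
      simpleReflection_mul_self, mul_one]
  rw [List.length_append, List.length_singleton] at h6
  omega

theorem length_mul_simpleReflection_of_isPos {w : P.weylGroup} {j : b.support}
    (h : b.IsPos (w • (j : ι))) :
    length (simpleReflection b) (w * simpleReflection b j) = length (simpleReflection b) w + 1 := by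
  rw [length_mul_simpleReflection_of_not_isPos b (w := w * simpleReflection b j) (j := j),
    mul_assoc, simpleReflection_mul_self, mul_one]
  have h1 : (w * simpleReflection b j) • (j : ι) = P.reflectionPerm (w • (j : ι)) (w • (j : ι)) := by
    rw [← ofIdx_smul_idx, ← mul_smul, ofIdx_smul]
    rfl
  rw [h1, isPos_reflectionPerm_self_iff, not_not]
  exact h

theorem length_lt_iff_isPos {w : P.weylGroup} {j : b.support} :
    length (simpleReflection b) w < length (simpleReflection b) (w * simpleReflection b j) ↔
      b.IsPos (w • (j : ι)) := by
  by_cases h : b.IsPos (w • (j : ι))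
  · have := length_mul_simpleReflection_of_isPos b h
    exact iff_of_true (by omega) h
  · have := length_mul_simpleReflection_of_not_isPos b h
    exact iff_of_false (by omega) h

/-- For the folding condition: whether s_i lengthens w is the sign of w⁻¹ α_i. Passing to w s_j
applies s_j to this root, which changes its sign only if it is ±α_j, and then s_i w = w s_j. -/
theorem isFoldingSystem_simpleReflection : IsFoldingSystem (simpleReflection b) where
  mul_self := simpleReflection_mul_self b
  closure_range := closure_range_simpleReflection b
  length_mul w j := by
    by_cases h : b.IsPos (w • (j : ι))
    · exact Or.inl (length_mul_simpleReflection_of_isPos b h)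
    · exact Or.inr (length_mul_simpleReflection_of_not_isPos b h)
  fold w i j := by
    have hinv (i : b.support) : (simpleReflection b i)⁻¹ = simpleReflection b i :=
      inv_eq_of_mul_eq_one_left (simpleReflection_mul_self b i)
    have hlen (w : P.weylGroup) : length (simpleReflection b) w < length (simpleReflection b)
        (simpleReflection b i * w) ↔ b.IsPos (w⁻¹ • (i : ι)) := by
      rw [← length_lt_iff_isPos, ← length_inv_of_closure (simpleReflection_mul_self b)
        (closure_range_simpleReflection b) w, ← length_inv_of_closure (simpleReflection_mul_self b)
        (closure_range_simpleReflection b) (simpleReflection b i * w), mul_inv_rev, hinv]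
    rw [hlen, mul_assoc, hlen, mul_inv_rev, hinv, mul_smul, simpleReflection_smul_idx]
    have hconj (hk : RootPairing.weylGroup.ofIdx P (w⁻¹ • (i : ι)) = simpleReflection b j) :
        simpleReflection b i * w = w * simpleReflection b j := by
      have := ofIdx_smul w⁻¹ (i : ι)
      rw [hk] at this
      change _ = w⁻¹ * simpleReflection b i at this
      rw [eq_inv_mul_iff_mul_eq, ← mul_assoc] at this
      rw [← this, inv_mul_cancel_right]
    by_cases h1 : w⁻¹ • (i : ι) = j
    · exact Or.inr (hconj (by rw [h1]; rfl))
    by_cases h2 : P.reflectionPerm (w⁻¹ • (i : ι)) (w⁻¹ • (i : ι)) = j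
    · exact Or.inr (hconj (by rw [← ofIdx_reflectionPerm_self, h2]; rfl))
    · exact Or.inl (isPos_reflectionPerm_iff b j.2 h1 h2).symm

theorem mem_rightDescents_iff {w : P.weylGroup} {i : b.support} :
    i ∈ rightDescents (simpleReflection b) w ↔ ¬ b.IsPos (w • (i : ι)) := by
  have := (isFoldingSystem_simpleReflection b).length_mul w i
  rw [← length_lt_iff_isPos, rightDescents, Set.mem_ofPred_eq]
  omega

variable {b} in
/-- The stabilizer of a dominant weight is a standard parabolic subgroup. -/
theorem IsDominant.mem_parabolic {x : X} (hx : IsDominant b x) {w : P.weylGroup} (h : w • x = x) :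
    w ∈ parabolic (simpleReflection b) {i | P.toLinearMap x (P.coroot i) = 0} := by
  induction w using (isFoldingSystem_simpleReflection b).induction_right with
  | one => exact one_mem _
  | mul w i hw ih =>
    have hpos := (length_lt_iff_isPos b (w := w) (j := i)).mp (by omega)
    have h1 := hx i i.2
    have h2 := hx.nonneg hpos
    -- Since w s_i fixes x, the pairing of x with the positive coroot at w α_i is minus its pairing
    -- with the simple coroot i; both are nonnegative, hence zero.
    have h3 := toLinearMap_smul_coroot_smul w (simpleReflection b i • x) (i : ι)
    rw [← mul_smul, h, simpleReflection_smul_weight, map_sub, LinearMap.map_smul,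
      LinearMap.sub_apply, LinearMap.smul_apply, P.root_coroot_two] at h3
    have h4 : P.toLinearMap x (P.coroot i) = 0 := by
      rw [smul_eq_mul] at h3
      omega
    refine mul_mem (ih ?_) (Subgroup.subset_closure ⟨i, h4, rfl⟩)
    rwa [mul_smul, simpleReflection_smul_weight, h4, zero_smul, sub_zero] at h

/-! ### The height functional and fundamental weights -/

open Classical in
/-- The pairing with the sum of the positive coroots. -/
def heightFunctional (b : P.Base) : X →ₗ[ℤ] ℤ :=
  have := Fintype.ofFinite ι
  ∑ i with b.IsPos i, P.toLinearMap.flip (P.coroot i)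

open Classical in
theorem reflectionPerm_mem_erase [Fintype ι] {j : ι} (hj : j ∈ b.support) (i : ι)
    (hi : i ∈ ({i | b.IsPos i} : Finset ι).erase j) :
    P.reflectionPerm j i ∈ ({i | b.IsPos i} : Finset ι).erase j := by
  simp only [Finset.mem_erase, Finset.mem_filter, Finset.mem_univ, true_and] at hi ⊢
  refine ⟨fun h => ?_, hi.2.reflectionPerm hj hi.1⟩
  have h2 : i = P.reflectionPerm j j := by
    nth_rw 2 [← h]
    rw [P.reflectionPerm_self]
  rw [h2, isPos_reflectionPerm_self_iff] at hi
  exact hi.2 (b.isPos_of_mem_support hj)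

/-- The reflection s_j permutes the positive coroots other than the j-th and negates α_j, so their
contributions cancel. -/
theorem heightFunctional_simple_root {j : ι} (hj : j ∈ b.support) : heightFunctional b (P.root j) = 2 := by
  classical
  let := Fintype.ofFinite ι
  have h0 : heightFunctional b (P.root j) =
      ∑ i with b.IsPos i, P.toLinearMap (P.root j) (P.coroot i) := by
    rw [heightFunctional, LinearMap.sum_apply]
    exact Finset.sum_congr (Finset.filter_congr_decidable ..) fun _ _ => rfl
  have hmem : j ∈ ({i | b.IsPos i} : Finset ι) := by simpa using b.isPos_of_mem_support hj
  rw [h0, ← Finset.add_sum_erase _ _ hmem, P.root_coroot_two]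
  have h1 : ∑ i ∈ ({i | b.IsPos i} : Finset ι).erase j, P.toLinearMap (P.root j) (P.coroot i) =
      ∑ i ∈ ({i | b.IsPos i} : Finset ι).erase j, -P.toLinearMap (P.root j) (P.coroot i) := by
    refine Finset.sum_nbij' (P.reflectionPerm j) (P.reflectionPerm j)
      (reflectionPerm_mem_erase b hj) (reflectionPerm_mem_erase b hj)
      (fun i _ => P.reflectionPerm_self j i) (fun i _ => P.reflectionPerm_self j i) fun i _ => ?_
    have h3 := toLinearMap_smul_coroot_smul (RootPairing.weylGroup.ofIdx P j) (P.root j) i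
    rw [ofIdx_smul_weight, P.root_coroot_two, ofIdx_smul_idx] at h3
    rw [← h3, two_smul, sub_add_cancel_left, map_neg, LinearMap.neg_apply]
  rw [Finset.sum_neg_distrib] at h1
  omega

theorem heightFunctional_root (i : ι) : heightFunctional b (P.root i) = 2 * b.height i := by
  obtain ⟨f, -, -, h⟩ := b.exists_root_eq_sum_int i
  rw [RootPairing.Base.height_eq_sum h, h, map_sum, Finset.mul_sum]
  refine Finset.sum_congr rfl fun j hj => ?_
  rw [LinearMap.map_smul, heightFunctional_simple_root b hj, smul_eq_mul, mul_comm]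

variable {b} in
theorem IsDominant.height_smul_le {x : X} (hx : IsDominant b x) (w : P.weylGroup) :
    heightFunctional b (w • x) ≤ heightFunctional b x ∧
      (heightFunctional b (w • x) = heightFunctional b x → w • x = x) := by
  -- With w inverted, lengthening w on the right by s_i subtracts from w⁻¹ x the multiple ⟨x, (w
  -- α_i)^∨⟩ ≥ 0 of α_i.
  rw [← inv_inv w]
  generalize w⁻¹ = w
  induction w using (isFoldingSystem_simpleReflection b).induction_right with
  | one => simp
  | mul w i hw ih =>
    have hpos := (length_lt_iff_isPos b (w := w) (j := i)).mp (by omega)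
    have h2 := hx.nonneg hpos
    rw [mul_inv_rev, (isFoldingSystem_simpleReflection b).inv_simple, mul_smul,
      simpleReflection_smul_weight, toLinearMap_smul_coroot, inv_inv, map_sub, LinearMap.map_smul,
      heightFunctional_simple_root b i.2, smul_eq_mul]
    refine ⟨by omega, fun h => ?_⟩
    have h3 : P.toLinearMap x (P.coroot (w • (i : ι))) = 0 := by omega
    rw [h3, zero_smul, sub_zero]
    exact ih.2 (by omega)

omit [Finite ι] [P.IsReduced] in
theorem toLinearMap_coroot_eq_zero {x : X} {i : ι} (h : RootPairing.weylGroup.ofIdx P i • x = x) :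
    P.toLinearMap x (P.coroot i) = 0 := by
  have := isAddTorsionFree_weight P
  rw [ofIdx_smul_weight, sub_eq_self] at h
  exact (smul_eq_zero.mp h).resolve_right (P.ne_zero i)

omit [Finite ι] [P.IsReduced] in
theorem eq_of_toLinearMap_coroot_eq (hsc : P.corootSpan ℤ = ⊤) {x x' : X}
    (h : ∀ i, P.toLinearMap x (P.coroot i) = P.toLinearMap x' (P.coroot i)) : x = x' := by
  refine P.toPerfPair.injective (LinearMap.ext fun y => ?_)
  have hy : y ∈ P.corootSpan ℤ := hsc ▸ Submodule.mem_top
  induction hy using Submodule.span_induction with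
  | mem y hy =>
    obtain ⟨i, rfl⟩ := hy
    exact h i
  | zero => rw [map_zero, map_zero]
  | add y y' _ _ h h' => rw [map_add, map_add, h, h']
  | smul a y _ h => rw [map_smul, map_smul, h]

omit [Finite ι] [P.IsReduced] in
theorem eq_zero_of_forall_smul_eq (hsc : P.corootSpan ℤ = ⊤) {x : X}
    (h : ∀ g : P.weylGroup, g • x = x) : x = 0 :=
  eq_of_toLinearMap_coroot_eq hsc fun i => by
    rw [toLinearMap_coroot_eq_zero (h _), map_zero, LinearMap.zero_apply]

omit [P.IsReduced] in
theorem finite_weylGroup (hsc : P.corootSpan ℤ = ⊤) : Finite P.weylGroup := by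
  refine Finite.of_injective (fun g : P.weylGroup => fun i : ι => g⁻¹ • i) fun g g' h => ?_
  refine weylGroup_eq_of_smul_weight_eq fun x => eq_of_toLinearMap_coroot_eq hsc fun i => ?_
  rw [toLinearMap_smul_coroot, toLinearMap_smul_coroot]
  rw [show g⁻¹ • i = g'⁻¹ • i from congrFun h i]

omit [Finite ι] [P.IsReduced] in
theorem weightSum_coroot (hsc : P.corootSpan ℤ = ⊤) (I : Set b.support) [DecidablePred (· ∈ I)]
    (j : b.support) : P.toLinearMap (weightSum b hsc I) (P.coroot j) = if j ∈ I then 1 else 0 := by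
  classical
  rw [weightSum, map_sum, LinearMap.sum_apply]
  simp only [fundamentalWeight_coroot]
  rw [Finset.sum_ite_eq']
  simp

omit [Finite ι] [P.IsReduced] in
theorem isDominant_weightSum (hsc : P.corootSpan ℤ = ⊤) (I : Set b.support) :
    IsDominant b (weightSum b hsc I) := by
  classical
  intro i hi
  rw [weightSum_coroot b hsc I ⟨i, hi⟩]
  split_ifs <;> simp

theorem smul_weightSum_compl_eq_iff (hsc : P.corootSpan ℤ = ⊤) (I : Set b.support)
    (w : P.weylGroup) : w • weightSum b hsc Iᶜ = weightSum b hsc Iᶜ ↔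
      w ∈ parabolic (simpleReflection b) I := by
  classical
  have hI : {i : b.support | P.toLinearMap (weightSum b hsc Iᶜ) (P.coroot i) = 0} = I := by
    ext i
    rw [Set.mem_ofPred_eq, weightSum_coroot]
    simp
  constructor
  · intro h
    have := (isDominant_weightSum b hsc Iᶜ).mem_parabolic h
    rwa [hI] at this
  · intro h
    induction h using Subgroup.closure_induction with
    | mem w hw =>
      obtain ⟨i, hi, rfl⟩ := hw
      rw [← hI] at hi
      rw [simpleReflection_smul_weight, hi, zero_smul, sub_zero]
    | one => exact one_smul _ _
    | mul w w' _ _ h h' => rw [mul_smul, h', h]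
    | inv w _ h => exact inv_smul_eq_iff.mpr h.symm

end Base

end KLSteinberg

end

noncomputable section

namespace KLSteinberg

/-! ### Divisibility in group rings of abelian groups -/

section Divisibility

/-- The coprimality used in this section is that q is a nonzerodivisor modulo p; no unique
factorization is required. -/
theorem pow_dvd_of_pow_dvd_mul {R : Type*} [CommRing R] [IsDomain R] {p q : R} (hp : p ≠ 0)
    (h : ∀ g, p ∣ q * g → p ∣ g) (m : ℕ) (g : R) (hg : p ^ m ∣ q * g) : p ^ m ∣ g := by
  induction m generalizing g with
  | zero => simp
  | succ m ih =>
    obtain ⟨k, rfl⟩ := h g ((dvd_pow_self p m.succ_ne_zero).trans hg)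
    rw [mul_left_comm, pow_succ'] at hg
    rw [pow_succ']
    exact mul_dvd_mul_left p (ih k ((mul_dvd_mul_iff_left hp).mp hg))

theorem pow_dvd_of_pow_dvd_prod_mul {R κ : Type*} [CommRing R] [IsDomain R] {p : R} (hp : p ≠ 0)
    (q : κ → R) (s : Finset κ) (h : ∀ i ∈ s, ∀ g, p ∣ q i * g → p ∣ g) (m : ℕ) (n : ℕ) (g : R)
    (hg : p ^ m ∣ (∏ i ∈ s, q i) ^ n * g) : p ^ m ∣ g := by
  have h1 : ∀ g : R, p ∣ (∏ i ∈ s, q i) * g → p ∣ g := by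
    clear hg g
    classical
    intro g hg
    induction s using Finset.induction_on with
    | empty => simpa using hg
    | insert i s hi ih =>
      rw [Finset.prod_insert hi, mul_assoc] at hg
      exact ih (fun j hj => h j (Finset.mem_insert_of_mem hj))
        (h i (Finset.mem_insert_self i s) _ hg)
  induction n generalizing g with
  | zero => simpa using hg
  | succ n ih =>
    rw [pow_succ, mul_assoc] at hg
    exact pow_dvd_of_pow_dvd_mul hp h1 m g (ih _ hg)

theorem prod_pow_dvd {R κ : Type*} [CommRing R] [IsDomain R] (q : κ → R) (s : Finset κ)
    (hq : ∀ i ∈ s, q i ≠ 0) (h : ∀ i ∈ s, ∀ j ∈ s, i ≠ j → ∀ g, q i ∣ q j * g → q i ∣ g)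
    (m : ℕ) (N : R) (hN : ∀ i ∈ s, q i ^ m ∣ N) : (∏ i ∈ s, q i) ^ m ∣ N := by
  classical
  induction s using Finset.induction_on with
  | empty => simp
  | insert i s hi ih =>
    obtain ⟨k, rfl⟩ := ih (fun j hj => hq j (Finset.mem_insert_of_mem hj))
      (fun j hj j' hj' => h j (Finset.mem_insert_of_mem hj) j' (Finset.mem_insert_of_mem hj'))
      (fun j hj => hN j (Finset.mem_insert_of_mem hj))
    rw [Finset.prod_insert hi, mul_pow, mul_comm]
    refine mul_dvd_mul_left _ ?_
    have hi' := Finset.mem_insert_self i s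
    refine pow_dvd_of_pow_dvd_prod_mul (hq i hi') q s (fun j hj => ?_) m m k (hN i hi')
    exact h i hi' j (Finset.mem_insert_of_mem hj) (by rintro rfl; exact hi hj)

variable {X : Type*} [AddCommGroup X]

/-- The element `exp x` of the group ring. -/
abbrev expo (x : X) : AddMonoidAlgebra ℤ X := AddMonoidAlgebra.single x 1

theorem expo_add (x y : X) : expo (x + y) = expo x * expo y := by
  rw [expo, AddMonoidAlgebra.single_mul_single, one_mul]

theorem expo_zero : expo (0 : X) = 1 := rfl

theorem expo_nsmul (n : ℕ) (x : X) : expo (n • x) = expo x ^ n := by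
  rw [expo, AddMonoidAlgebra.single_pow, one_pow]

theorem expo_mul_expo_neg (x : X) : expo x * expo (-x) = 1 := by
  rw [← expo_add, add_neg_cancel, expo_zero]

theorem one_sub_expo_dvd_one_sub_expo_zsmul (a : X) (n : ℤ) : 1 - expo a ∣ 1 - expo (n • a) := by
  have key (n : ℕ) : 1 - expo a ∣ 1 - expo (n • a) := by
    rw [expo_nsmul]
    exact one_sub_dvd_one_sub_pow _ n
  obtain ⟨n, rfl | rfl⟩ := n.eq_nat_or_neg
  · rw [natCast_zsmul]
    exact key n
  · have h : 1 - expo (-(n : ℤ) • a) = -expo (-(n : ℤ) • a) * (1 - expo (n • a)) := by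
      rw [neg_smul, natCast_zsmul, mul_sub, neg_mul, neg_mul, mul_one, mul_comm, expo_mul_expo_neg]
      ring
    rw [h]
    exact (key n).mul_left _

theorem one_sub_expo_dvd_expo_sub (a x : X) (n : ℤ) :
    1 - expo a ∣ expo x - expo (x + n • a) := by
  rw [expo_add, ← mul_one_sub]
  exact (one_sub_expo_dvd_one_sub_expo_zsmul a n).mul_left _

/-- Modulo 1 - exp a, each exponent may be moved to a fixed representative of its coset of ℤa, so f
is congruent to a lift of its image in ℤ[X/ℤa]. -/
theorem one_sub_expo_dvd_iff (a : X) (f : AddMonoidAlgebra ℤ X) : 1 - expo a ∣ f ↔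
    AddMonoidAlgebra.mapDomainRingHom ℤ (QuotientAddGroup.mk' (AddSubgroup.zmultiples a)) f = 0 := by
  constructor
  · rintro ⟨g, rfl⟩
    have h : QuotientAddGroup.mk' (AddSubgroup.zmultiples a) a = 0 := by
      rw [QuotientAddGroup.mk'_apply, QuotientAddGroup.eq_zero_iff]
      exact AddSubgroup.mem_zmultiples a
    have h' : AddMonoidAlgebra.mapDomainRingHom ℤ (QuotientAddGroup.mk' (AddSubgroup.zmultiples a))
        (expo a) = 1 := by
      rw [AddMonoidAlgebra.mapDomainRingHom_apply, AddMonoidAlgebra.mapDomain_single]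
      exact congrArg expo h
    rw [map_mul, map_sub, map_one, h', sub_self, zero_mul]
  · intro h
    let π := QuotientAddGroup.mk' (AddSubgroup.zmultiples a)
    let σ : X → X := fun x => (π x).out
    have key : ∀ f : AddMonoidAlgebra ℤ X,
        1 - expo a ∣ f - AddMonoidAlgebra.mapDomain Quotient.out
          (AddMonoidAlgebra.mapDomain π f) := by
      intro f
      induction f using AddMonoidAlgebra.induction_linear with
      | zero => simp
      | add f g hf hg =>
        rw [AddMonoidAlgebra.mapDomain_add, AddMonoidAlgebra.mapDomain_add, add_sub_add_comm]
        exact dvd_add hf hg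
      | single x r =>
        rw [AddMonoidAlgebra.mapDomain_single, AddMonoidAlgebra.mapDomain_single]
        have h1 : (QuotientAddGroup.mk x : X ⧸ AddSubgroup.zmultiples a) =
          QuotientAddGroup.mk (Quotient.out (π x)) := (Quotient.out_eq (π x)).symm
        obtain ⟨n, hn⟩ := AddSubgroup.mem_zmultiples_iff.mp (QuotientAddGroup.eq.mp h1)
        have h2 : Quotient.out (π x) = x + n • a := by
          rw [hn, add_neg_cancel_left]
        rw [h2]
        have h3 : (AddMonoidAlgebra.single x r - AddMonoidAlgebra.single (x + n • a) r :
            AddMonoidAlgebra ℤ X) = AddMonoidAlgebra.single 0 r * (expo x - expo (x + n • a)) := by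
          simp [mul_sub, AddMonoidAlgebra.single_mul_single]
        rw [h3]
        exact (one_sub_expo_dvd_expo_sub a x n).mul_left _
    have h' : AddMonoidAlgebra.mapDomain π f = 0 := h
    have := key f
    rwa [h', AddMonoidAlgebra.mapDomain_zero, sub_zero] at this

/-- The coefficients of g are constant along the infinite progressions x - n b, but g has finite
support. -/
theorem eq_zero_of_one_sub_expo_mul_eq_zero {b : X} (hb : ∀ n : ℕ, n ≠ 0 → n • b ≠ 0)
    {g : AddMonoidAlgebra ℤ X} (h : (1 - expo b) * g = 0) : g = 0 := by
  have h1 (x : X) : g.coeff (x - b) = g.coeff x := by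
    have := congrArg (fun f : AddMonoidAlgebra ℤ X => f.coeff x) h
    rw [sub_mul, one_mul] at this
    simp only [AddMonoidAlgebra.coeff_sub, Finsupp.sub_apply,
      AddMonoidAlgebra.coeff_single_mul_apply, one_mul, AddMonoidAlgebra.coeff_zero,
      Finsupp.zero_apply] at this
    rw [sub_eq_add_neg, add_comm]
    omega
  have h2 (x : X) (n : ℕ) : g.coeff (x - n • b) = g.coeff x := by
    induction n with
    | zero => simp
    | succ n ih => rw [succ_nsmul, ← sub_sub, h1, ih]
  ext x
  by_contra hx
  change g.coeff x ≠ 0 at hx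
  have hinj : Function.Injective fun n : ℕ => x - n • b := by
    intro n m hnm
    have hnm' : n • b = m • b := sub_right_injective hnm
    rcases lt_trichotomy n m with hlt | rfl | hlt
    · refine absurd ?_ (hb (m - n) (by omega))
      rw [sub_nsmul _ hlt.le, hnm', add_neg_cancel]
    · rfl
    · refine absurd ?_ (hb (n - m) (by omega))
      rw [sub_nsmul _ hlt.le, hnm', add_neg_cancel]
  refine Set.infinite_range_of_injective hinj (g.coeff.support.finite_toSet.subset ?_)
  rintro _ ⟨n, rfl⟩
  rw [Finset.mem_coe, Finsupp.mem_support_iff, h2]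
  exact hx

theorem one_sub_expo_dvd_of_dvd_mul {a b : X} (hab : LinearIndependent ℤ ![a, b])
    (g : AddMonoidAlgebra ℤ X) (h : 1 - expo a ∣ (1 - expo b) * g) : 1 - expo a ∣ g := by
  rw [one_sub_expo_dvd_iff] at h ⊢
  rw [map_mul, map_sub, map_one] at h
  refine eq_zero_of_one_sub_expo_mul_eq_zero
    (b := QuotientAddGroup.mk' (AddSubgroup.zmultiples a) b) ?_ ?_
  · intro n hn h0
    rw [← map_nsmul, QuotientAddGroup.mk'_apply, QuotientAddGroup.eq_zero_iff,
      AddSubgroup.mem_zmultiples_iff] at h0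
    obtain ⟨k, hk⟩ := h0
    have := LinearIndependent.pair_iff.mp hab k (-n) (by rw [hk]; simp)
    omega
  · simpa using h

theorem isDomain_groupRing [IsAddTorsionFree X] [Module.Finite ℤ X] :
    IsDomain (AddMonoidAlgebra ℤ X) := by
  have : AddMonoid.FG X := by
    rw [← AddGroup.fg_iff_addMonoid_fg, ← Module.Finite.iff_addGroup_fg]
    infer_instance
  have : NoZeroDivisors (AddMonoidAlgebra ℤ X) := inferInstance
  exact NoZeroDivisors.to_isDomain _

end Divisibility

/-! ### Determinants of matrices whose rows are congruent in pairs -/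

/-- Subtracting row σ y from row y, for each y outside p, makes these rows divisible by a. The row
operation and the extraction of a are recorded together in the block triangular factor `L`. -/
theorem pow_dvd_det_of_involution {R W : Type*} [CommRing R] [Fintype W] [DecidableEq W]
    (M : Matrix W W R) (σ : W → W) (p : W → Prop) [DecidablePred p]
    (hp : ∀ x, p (σ x) ↔ ¬ p x) (a : R) (h : ∀ x w, a ∣ M (σ x) w - M x w) :
    a ^ Fintype.card {x // ¬ p x} ∣ M.det := by
  choose N hN using h
  let e := Equiv.sumCompl p
  let L : Matrix ({x // p x} ⊕ {x // ¬ p x}) ({x // p x} ⊕ {x // ¬ p x}) R :=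
    Matrix.fromBlocks 1 0 (Matrix.of fun y x => if σ y = x then 1 else 0) (a • 1)
  let M' : Matrix ({x // p x} ⊕ {x // ¬ p x}) ({x // p x} ⊕ {x // ¬ p x}) R :=
    Matrix.of fun x w => Sum.elim (fun x : {x // p x} => M x (e w))
      (fun y : {x // ¬ p x} => -N y (e w)) x
  have hM : M.submatrix e e = L * M' := by
    ext x w
    rw [Matrix.mul_apply, Fintype.sum_sum_type]
    rcases x with x | y
    · simp [L, M', e, Matrix.one_apply]
    · have hy : p (σ y) := (hp y).mpr y.2
      simp only [Matrix.fromBlocks_apply₂₁, Matrix.of_apply, Sum.elim_inl, Matrix.smul_apply,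
        Sum.elim_inr, L, M', e, Matrix.submatrix_apply, Matrix.fromBlocks_apply₂₂, Matrix.one_apply,
        smul_eq_mul, mul_ite, ite_mul, mul_one, mul_zero, zero_mul, one_mul, Finset.sum_ite_eq,
        Finset.mem_univ, if_true, Equiv.sumCompl_apply_inr]
      rw [Finset.sum_eq_single ⟨σ y, hy⟩]
      · rw [if_pos rfl, mul_neg, ← hN]
        ring
      · intro z _ hz
        rw [if_neg]
        intro h
        exact hz (Subtype.ext h.symm)
      · simp
  rw [← Matrix.det_submatrix_equiv_self e, hM, Matrix.det_mul, Matrix.det_fromBlocks_zero₁₂,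
    Matrix.det_one, one_mul, Matrix.det_smul, Matrix.det_one, mul_one]
  exact dvd_mul_right _ _

theorem two_mul_card_of_involution {W : Type*} [Fintype W] (σ : W → W) (hσ : ∀ x, σ (σ x) = x)
    (p : W → Prop) [DecidablePred p] (hp : ∀ x, p (σ x) ↔ ¬ p x) :
    2 * Fintype.card {x // ¬ p x} = Fintype.card W := by
  classical
  have h1 := Fintype.card_subtype_compl p
  have h2 : Fintype.card {x // p x} = Fintype.card {x // ¬ p x} :=
    Fintype.card_congr ⟨fun x => ⟨σ x, by rw [hp, not_not]; exact x.2⟩,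
      fun x => ⟨σ x, (hp x).mpr x.2⟩, fun x => Subtype.ext (hσ x), fun x => Subtype.ext (hσ x)⟩
  have h3 := Fintype.card_subtype_le p
  omega

end KLSteinberg

end

noncomputable section

namespace KLSteinberg

open KazhdanLusztig

/-! ### Leading terms in group rings -/

section LeadingTerm

variable {X : Type*} [AddCommGroup X] (h : X →ₗ[ℤ] ℤ)

/-- Every nonconstant term of f lowers the height strictly, so it cannot reach x from the support of
g. -/
theorem coeff_mul_of_le {f g : AddMonoidAlgebra ℤ X} {n : ℤ} {x : X}
    (hf : ∀ y, f.coeff y ≠ 0 → y = 0 ∨ h y < 0) (hg : ∀ y, g.coeff y ≠ 0 → h y ≤ n)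
    (hx : n ≤ h x) : (f * g).coeff x = f.coeff 0 * g.coeff x := by
  rw [AddMonoidAlgebra.coeff_mul_apply_left, Finsupp.sum, Finset.sum_eq_single 0]
  · rw [neg_zero, zero_add]
  · intro y hy hy0
    have h1 := (hf y (Finsupp.mem_support_iff.mp hy)).resolve_left hy0
    have h2 : g.coeff (-y + x) = 0 := by
      by_contra h3
      have := hg _ h3
      rw [map_add, map_neg] at this
      omega
    rw [h2, mul_zero]
  · intro h0
    rw [Finsupp.notMem_support_iff.mp h0, zero_mul]

/-- The subring of elements whose nonconstant terms have negative height. -/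
def negSubring : Subring (AddMonoidAlgebra ℤ X) where
  carrier := {f | ∀ x, f.coeff x ≠ 0 → x = 0 ∨ h x < 0}
  mul_mem' {f g} hf hg x hx := by
    by_contra! h0
    refine hx ?_
    have hg' : ∀ y, g.coeff y ≠ 0 → h y ≤ 0 := by
      intro y hy
      rcases hg y hy with rfl | hlt
      · rw [map_zero]
      · exact hlt.le
    rw [coeff_mul_of_le h hf hg' h0.2]
    by_cases hgx : g.coeff x = 0
    · rw [hgx, mul_zero]
    · exact absurd (hg x hgx) (by simpa using h0)
  one_mem' x hx := by
    left
    by_contra h0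
    refine hx ?_
    rw [AddMonoidAlgebra.one_def, AddMonoidAlgebra.coeff_single, Finsupp.single_eq_of_ne h0]
  add_mem' {f g} hf hg x hx := by
    by_cases h0 : f.coeff x = 0
    · refine hg x fun h1 => hx ?_
      rw [AddMonoidAlgebra.coeff_add, Finsupp.add_apply, h0, h1, add_zero]
    · exact hf x h0
  zero_mem' x hx := absurd rfl hx
  neg_mem' {f} hf x hx := by
    refine hf x fun h0 => hx ?_
    rw [AddMonoidAlgebra.coeff_neg, Finsupp.neg_apply, h0, neg_zero]

variable {h}

theorem single_mem_negSubring {x : X} (hx : x = 0 ∨ h x < 0) (r : ℤ) :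
    AddMonoidAlgebra.single x r ∈ negSubring h := by
  classical
  intro y hy
  rw [AddMonoidAlgebra.coeff_single, Finsupp.single_apply] at hy
  split_ifs at hy with hxy
  · rwa [← hxy]
  · exact absurd rfl hy

theorem height_nonpos_of_mem_negSubring {f : AddMonoidAlgebra ℤ X} (hf : f ∈ negSubring h) (x : X)
    (hx : f.coeff x ≠ 0) : h x ≤ 0 := by
  rcases hf x hx with rfl | hlt
  · rw [map_zero]
  · exact hlt.le

variable (h) in
/-- The constant coefficient is multiplicative on the elements whose other terms have negative
height. -/
def constCoeff : negSubring h →+* ℤ where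
  toFun f := f.1.coeff 0
  map_one' := AddMonoidAlgebra.coeff_one_zero
  map_mul' f g := coeff_mul_of_le h f.2 (height_nonpos_of_mem_negSubring g.2) (by rw [map_zero])
  map_zero' := rfl
  map_add' _ _ := rfl

/-- Division by an element of constant coefficient `1`. -/
theorem mem_negSubring_of_mul_mem {f g : AddMonoidAlgebra ℤ X} (hf : f ∈ negSubring h)
    (hf1 : f.coeff 0 = 1) (hfg : f * g ∈ negSubring h) (h0 : (f * g).coeff 0 ≠ 0) :
    g ∈ negSubring h ∧ g.coeff 0 = (f * g).coeff 0 := by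
  have hg0 : g.coeff.support.Nonempty := by
    rw [Finsupp.support_nonempty_iff]
    intro hg
    rw [AddMonoidAlgebra.coeff_eq_zero] at hg
    rw [hg, mul_zero] at h0
    exact h0 rfl
  -- The terms of g of maximal height survive unchanged in f * g, which forces that height to be 0.
  obtain ⟨x, hx, hmax⟩ := Finset.exists_max_image _ h hg0
  have hle : ∀ y, g.coeff y ≠ 0 → h y ≤ h x := fun y hy => hmax y (Finsupp.mem_support_iff.mpr hy)
  have key : ∀ y, h x ≤ h y → (f * g).coeff y = g.coeff y := by
    intro y hy
    rw [coeff_mul_of_le h hf hle hy, hf1, one_mul]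
  have hx0 : 0 ≤ h x := by
    by_contra! hlt
    rw [key 0 (by rw [map_zero]; exact hlt.le)] at h0
    have := hle 0 h0
    rw [map_zero] at this
    omega
  have h1 : ∀ y, h x ≤ h y → g.coeff y ≠ 0 → y = 0 := by
    intro y hy hgy
    rw [← key y hy] at hgy
    exact (hfg y hgy).resolve_right (by omega)
  have hx' : x = 0 := h1 x le_rfl (Finsupp.mem_support_iff.mp hx)
  rw [hx', map_zero] at hle key h1
  refine ⟨fun y hy => ?_, (key 0 (by rw [map_zero])).symm⟩
  rcases (hle y hy).lt_or_eq with hlt | heq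
  · exact Or.inr hlt
  · exact Or.inl (h1 y heq.ge hy)

/-- The determinant of a matrix over the subring, and its constant coefficient. -/
theorem det_mem_negSubring {n : Type*} [Fintype n] [DecidableEq n]
    (M : Matrix n n (AddMonoidAlgebra ℤ X)) (hM : ∀ i j, M i j ∈ negSubring h) :
    M.det ∈ negSubring h ∧ M.det.coeff 0 = (Matrix.of fun i j => (M i j).coeff 0).det := by
  let N : Matrix n n (negSubring h) := Matrix.of fun i j => ⟨M i j, hM i j⟩
  have h1 : M.det = N.det.1 := by
    change _ = (negSubring h).subtype N.det
    rw [RingHom.map_det]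
    rfl
  rw [h1]
  refine ⟨N.det.2, ?_⟩
  change constCoeff h N.det = _
  rw [RingHom.map_det]
  rfl

end LeadingTerm

/-! ### Unitriangular matrices -/

/-- The matrix is block triangular for the level sets of ℓ, with identity blocks on the diagonal; no
total order is needed. -/
theorem det_eq_one_of_unitriangular {n : Type*} [Fintype n] [DecidableEq n] (ℓ : n → ℕ)
    (M : Matrix n n ℤ) (h1 : ∀ i, M i i = 1) (h2 : ∀ i j, i ≠ j → ℓ j ≤ ℓ i → M i j = 0) :
    M.det = 1 := by
  have hM : M.BlockTriangular ℓ := fun i j hij => h2 i j (by rintro rfl; exact lt_irrefl _ hij) hij.le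
  rw [hM.det]
  refine Finset.prod_eq_one fun k _ => ?_
  have : M.toSquareBlock ℓ k = 1 := by
    ext i j
    rw [Matrix.toSquareBlock_def, Matrix.of_apply, Matrix.one_apply]
    split_ifs with hij
    · rw [hij, h1]
    · exact h2 _ _ (fun h => hij (Subtype.ext h)) (by rw [i.2, j.2])
  rw [this, Matrix.det_one]

/-! ### Sums over cosets -/

theorem sum_eq_card_nsmul_sum_quotient {G M : Type*} [Group G] [Fintype G] [AddCommMonoid M]
    (H : Subgroup G) [Fintype (G ⧸ H)] (φ : G → M) (hφ : ∀ y, ∀ z ∈ H, φ (y * z) = φ y) :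
    ∑ y, φ y = Nat.card H • ∑ q : G ⧸ H, φ q.out := by
  classical
  have := Fintype.ofFinite H
  have hmk (q : G ⧸ H) (z : H) : (QuotientGroup.mk (q.out * z) : G ⧸ H) = q := by
    rw [QuotientGroup.mk_mul_of_mem _ z.2, QuotientGroup.out_eq']
  have hbij : Function.Bijective fun p : (G ⧸ H) × H => p.1.out * (p.2 : G) := by
    constructor
    · rintro ⟨q, z⟩ ⟨q', z'⟩ h
      dsimp only at h
      have hq : q = q' := by rw [← hmk q z, h, hmk]
      subst hq
      rw [mul_right_inj] at h
      rw [Subtype.ext h]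
    · intro y
      have hy : (QuotientGroup.mk y : G ⧸ H).out⁻¹ * y ∈ H := by
        rw [← QuotientGroup.eq, QuotientGroup.out_eq']
      exact ⟨⟨QuotientGroup.mk y, ⟨_, hy⟩⟩, mul_inv_cancel_left _ _⟩
  rw [← hbij.sum_comp, Fintype.sum_prod_type, Finset.smul_sum]
  refine Finset.sum_congr rfl fun q _ => ?_
  simp [hφ, Nat.card_eq_fintype_card]

end KLSteinberg

end

noncomputable section

namespace KLSteinberg

open KazhdanLusztig

variable {ι X Y : Type*} [AddCommGroup X] [AddCommGroup Y]

/-! ### Orbit matrices and the Weyl denominator -/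

section WeylAct

variable (P : RootPairing ι ℤ X Y)

theorem weylAct_single {R : Type*} [CommRing R] (w : P.weylGroup) (x : X) (r : R) :
    weylAct P R w (AddMonoidAlgebra.single x r) = AddMonoidAlgebra.single (w • x) r := by
  rw [weylAct, AddMonoidAlgebra.mapDomainRingHom_apply, AddMonoidAlgebra.mapDomain_single]
  rfl

theorem weylAct_mul_apply (w w' : P.weylGroup) (f : AddMonoidAlgebra ℤ X) :
    weylAct P ℤ (w * w') f = weylAct P ℤ w (weylAct P ℤ w' f) := by
  induction f using AddMonoidAlgebra.induction_linear with
  | zero => simp only [map_zero]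
  | add f g hf hg => rw [map_add, map_add, map_add, hf, hg]
  | single x r => rw [weylAct_single, weylAct_single, weylAct_single, mul_smul]

theorem weylAct_one_apply (f : AddMonoidAlgebra ℤ X) : weylAct P ℤ 1 f = f := by
  induction f using AddMonoidAlgebra.induction_linear with
  | zero => simp only [map_zero]
  | add f g hf hg => rw [map_add, hf, hg]
  | single x r => rw [weylAct_single, one_smul]

theorem coeff_weylAct_smul (w : P.weylGroup) (f : AddMonoidAlgebra ℤ X) (x : X) :
    (weylAct P ℤ w f).coeff (w • x) = f.coeff x :=
  Finsupp.mapDomain_apply (MulAction.injective w) _ _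

/-- The action of a reflection is trivial modulo `1 - exp (-α)`. -/
theorem one_sub_expo_dvd_weylAct_sub (i : ι) (f : AddMonoidAlgebra ℤ X) :
    1 - expo (-P.root i) ∣ weylAct P ℤ (RootPairing.weylGroup.ofIdx P i) f - f := by
  induction f using AddMonoidAlgebra.induction_linear with
  | zero => simp
  | add f g hf hg =>
    rw [map_add, add_sub_add_comm]
    exact dvd_add hf hg
  | single x r =>
    rw [weylAct_single, ofIdx_smul_weight, sub_eq_add_neg x, ← smul_neg]
    generalize P.toLinearMap x (P.coroot i) = n
    have h : (AddMonoidAlgebra.single (x + n • -P.root i) r - AddMonoidAlgebra.single x r :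
        AddMonoidAlgebra ℤ X) =
        AddMonoidAlgebra.single 0 (-r) * (expo x - expo (x + n • -P.root i)) := by
      simp [mul_sub, AddMonoidAlgebra.single_mul_single, AddMonoidAlgebra.single_neg]
      abel
    rw [h]
    exact (one_sub_expo_dvd_expo_sub _ _ _).mul_left _

/-- The matrix `(x g_w)_{x, w}` for a family `g` indexed by the Weyl group. -/
def orbitMatrix (g : P.weylGroup → AddMonoidAlgebra ℤ X) :
    Matrix P.weylGroup P.weylGroup (AddMonoidAlgebra ℤ X) :=
  Matrix.of fun x w => weylAct P ℤ x (g w)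

end WeylAct

variable {P : RootPairing ι ℤ X Y} (b : P.Base)

/-- The product of the elements `1 - exp (-α)` over the positive roots. -/
def weylDenominator [Finite ι] : AddMonoidAlgebra ℤ X :=
  have := Fintype.ofFinite ι
  open Classical in ∏ i with b.IsPos i, (1 - expo (-P.root i))

section Det

variable [Finite ι] [P.IsReduced] [Fintype P.weylGroup] [DecidableEq P.weylGroup]

omit [Finite ι] [P.IsReduced] [Fintype P.weylGroup] [DecidableEq P.weylGroup] in
theorem isPos_smul_iff_not_of_reflection (i : ι) (x : P.weylGroup) :
    b.IsPos ((RootPairing.weylGroup.ofIdx P i * x)⁻¹ • i) ↔ ¬ b.IsPos (x⁻¹ • i) := by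
  rw [← isPos_reflectionPerm_self_iff, mul_inv_rev, mul_smul,
    inv_eq_of_mul_eq_one_left (ofIdx_mul_self i), ← ofIdx_smul_idx, ← mul_smul, ← mul_smul,
    ofIdx_smul]

/-- For each positive α, rows x and s_α x agree modulo 1 - exp(-α), and there are |W|/2 such pairs.
Distinct positive roots are linearly independent by reducedness, so the powers multiply. -/
theorem weylDenominator_pow_dvd_det [IsDomain (AddMonoidAlgebra ℤ X)]
    (g : P.weylGroup → AddMonoidAlgebra ℤ X) :
    weylDenominator b ^ (Fintype.card P.weylGroup / 2) ∣ (orbitMatrix P g).det := by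
  classical
  refine prod_pow_dvd _ _ ?_ ?_ _ _ ?_
  · intro i _ h0
    rw [sub_eq_zero, AddMonoidAlgebra.one_def, expo, AddMonoidAlgebra.single_left_inj one_ne_zero,
      eq_comm, neg_eq_zero] at h0
    exact P.ne_zero i h0
  · intro i hi j hj hij
    have := isAddTorsionFree_weight P
    refine one_sub_expo_dvd_of_dvd_mul ?_
    simp only [Finset.mem_filter, Finset.mem_univ, true_and] at hi hj
    have hlin : LinearIndependent ℤ ![P.root i, P.root j] := by
      refine RootPairing.IsReduced.linearIndependent P hij fun h => ?_
      have h1 : i = P.reflectionPerm j j := P.root.injective (by rw [h]; simp)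
      rw [h1, isPos_reflectionPerm_self_iff] at hi
      exact hi hj
    rw [LinearIndependent.pair_iff] at hlin ⊢
    intro s t hst
    have := hlin (-s) (-t) (by simpa using hst)
    omega
  · intro i _
    have hcard := two_mul_card_of_involution (fun x => RootPairing.weylGroup.ofIdx P i * x)
      (fun x => by rw [← mul_assoc, ofIdx_mul_self, one_mul]) (fun x => b.IsPos (x⁻¹ • i))
      (isPos_smul_iff_not_of_reflection b i)
    have : Fintype.card P.weylGroup / 2 = Fintype.card {x : P.weylGroup // ¬ b.IsPos (x⁻¹ • i)} := by
      omega
    rw [this]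
    refine pow_dvd_det_of_involution _ (fun x => RootPairing.weylGroup.ofIdx P i * x)
      (fun x => b.IsPos (x⁻¹ • i)) (isPos_smul_iff_not_of_reflection b i) _ fun x w => ?_
    simp only [orbitMatrix, Matrix.of_apply, weylAct_mul_apply]
    exact one_sub_expo_dvd_weylAct_sub P i _

omit [Finite ι] [P.IsReduced] in
theorem weylAct_det (z : P.weylGroup) (g : P.weylGroup → AddMonoidAlgebra ℤ X) :
    ∃ ε : ℤˣ, weylAct P ℤ z (orbitMatrix P g).det = ((ε : ℤ) : AddMonoidAlgebra ℤ X) *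
      (orbitMatrix P g).det := by
  refine ⟨Equiv.Perm.sign (Equiv.mulLeft z), ?_⟩
  rw [← Matrix.det_permute, RingHom.map_det]
  congr 1
  ext1 x w
  simp [orbitMatrix, weylAct_mul_apply]

-- The reflection s_i permutes the factors of the other positive roots, and 1 - exp(α_i) =
-- -exp(α_i)(1 - exp(-α_i)).
omit [Fintype P.weylGroup] [DecidableEq P.weylGroup] in
theorem weylAct_simple_weylDenominator (i : b.support) :
    weylAct P ℤ (simpleReflection b i) (weylDenominator b) =
      -expo (P.root i) * weylDenominator b := by
  classical
  let := Fintype.ofFinite ι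
  have h0 : weylDenominator b = ∏ i with b.IsPos i, (1 - expo (-P.root i)) := by
    rw [weylDenominator]
  have hmem : (i : ι) ∈ ({i | b.IsPos i} : Finset ι) := by simpa using b.isPos_of_mem_support i.2
  rw [h0, ← Finset.mul_prod_erase _ _ hmem, map_mul, map_prod]
  have h1 : ∏ j ∈ ({i | b.IsPos i} : Finset ι).erase i,
      weylAct P ℤ (simpleReflection b i) (1 - expo (-P.root j)) =
      ∏ j ∈ ({i | b.IsPos i} : Finset ι).erase i, (1 - expo (-P.root j)) := by
    refine Finset.prod_nbij' (P.reflectionPerm i) (P.reflectionPerm i)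
      (reflectionPerm_mem_erase b i.2) (reflectionPerm_mem_erase b i.2)
      (fun j _ => P.reflectionPerm_self i j) (fun j _ => P.reflectionPerm_self i j) fun j _ => ?_
    rw [map_sub, map_one, weylAct_single, smul_neg, ← root_weylGroup_smul,
      simpleReflection_smul_idx]
  have h2 : simpleReflection b i • -P.root i = P.root i := by
    rw [smul_neg, simpleReflection_smul_weight, P.root_coroot_two]
    module
  rw [h1, map_sub, map_one, weylAct_single, h2, ← mul_assoc, neg_mul, mul_sub, expo_mul_expo_neg]
  ring

end Det

end KLSteinberg

end

noncomputable section

namespace KLSteinberg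

open KazhdanLusztig

variable {ι X Y : Type*} [AddCommGroup X] [AddCommGroup Y] {P : RootPairing ι ℤ X Y} (b : P.Base)

/-! ### Integrality of the Kazhdan–Lusztig–Steinberg elements -/

section Integrality

variable (hsc : P.corootSpan ℤ = ⊤)

/-- The weight `ω_J`, where `J` is the complement of the right descent set of `w`. -/
def ascentWeight (w : P.weylGroup) : X :=
  weightSum b hsc (rightDescents (simpleReflection b) w)ᶜ

/-- The standard parabolic subgroup attached to the right descent set of `w`. -/
def descentParabolic (w : P.weylGroup) : Subgroup P.weylGroup :=
  parabolic (simpleReflection b) (rightDescents (simpleReflection b) w)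

/-- The Kazhdan–Lusztig–Steinberg element as an element of `ℤ[T]`. -/
def integralKLSElt (w : P.weylGroup) : AddMonoidAlgebra ℤ X :=
  ∑ᶠ q : P.weylGroup ⧸ descentParabolic b w, AddMonoidAlgebra.single (q.out • ascentWeight b hsc w)
    ((klPoly (simpleReflection b) w q.out).eval 1)

variable [Finite ι] [P.IsReduced]

theorem smul_ascentWeight_eq_iff (w x : P.weylGroup) :
    x • ascentWeight b hsc w = ascentWeight b hsc w ↔ x ∈ descentParabolic b w :=
  smul_weightSum_compl_eq_iff b hsc _ x

omit [Finite ι] [P.IsReduced] in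
theorem klC'_coeff [Finite P.weylGroup] (w y : P.weylGroup) :
    (klC' (simpleReflection b) w).coeff y = (klPoly (simpleReflection b) w y).eval 1 := by
  classical
  have := Fintype.ofFinite P.weylGroup
  rw [klC', finsum_eq_sum_of_fintype, MonoidAlgebra.coeff_sum, Finsupp.finsetSum_apply]
  simp [Finsupp.single_apply]

/-- The summand at y depends only on the coset of y, so summing over W repeats each coset term
exactly as often as the denominator divides out. -/
theorem mapRingHom_integralKLSElt (w : P.weylGroup) :
    AddMonoidAlgebra.mapRingHom X (Int.castRingHom ℂ) (integralKLSElt b hsc w) =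
      klsElt b hsc w := by
  classical
  have := finite_weylGroup hsc
  have := Fintype.ofFinite P.weylGroup
  have := Fintype.ofFinite (P.weylGroup ⧸ descentParabolic b w)
  have hs := isFoldingSystem_simpleReflection b
  let φ : P.weylGroup → AddMonoidAlgebra ℂ X := fun y =>
    AddMonoidAlgebra.single (y • ascentWeight b hsc w)
      (((klPoly (simpleReflection b) w y).eval 1 : ℤ) : ℂ)
  have h1 : groupRingAct P (klC' (simpleReflection b) w)
      (AddMonoidAlgebra.single (ascentWeight b hsc w) 1) = ∑ y, φ y := by
    rw [groupRingAct, Finsupp.sum_fintype _ (fun y (c : ℤ) => c • weylAct P ℂ y _)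
      (fun _ => zero_smul _ _)]
    refine Finset.sum_congr rfl fun y _ => ?_
    rw [klC'_coeff, weylAct_single, AddMonoidAlgebra.smul_single, zsmul_eq_mul, mul_one]
  have h2 : ∀ y, ∀ z ∈ descentParabolic b w, φ (y * z) = φ y := by
    intro y z hz
    simp only [φ]
    rw [mul_smul, (smul_ascentWeight_eq_iff b hsc w z).mpr hz, hs.klPoly_mul_of_mem_parabolic hz]
  have h3 : (Nat.card (descentParabolic b w) : ℂ) ≠ 0 := Nat.cast_ne_zero.mpr Nat.card_pos.ne'
  change _ = (Nat.card (descentParabolic b w) : ℂ)⁻¹ • groupRingAct P (klC' (simpleReflection b) w)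
      (AddMonoidAlgebra.single (ascentWeight b hsc w) 1)
  rw [h1, sum_eq_card_nsmul_sum_quotient (descentParabolic b w) φ h2, ← Nat.cast_smul_eq_nsmul ℂ,
    smul_smul, inv_mul_cancel₀ h3, one_smul, integralKLSElt, finsum_eq_sum_of_fintype, map_sum]
  refine Finset.sum_congr rfl fun q _ => ?_
  simp [φ]

/-! ### The leading terms of the matrix of conjugates -/

/-- Only the coset of x⁻¹ contributes, the stabilizer of the weight being exactly the descent
parabolic. -/
theorem coeff_weylAct_integralKLSElt (w x : P.weylGroup) :
    (weylAct P ℤ x (integralKLSElt b hsc w)).coeff (ascentWeight b hsc w) =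
      (klPoly (simpleReflection b) w x⁻¹).eval 1 := by
  classical
  have := finite_weylGroup hsc
  have := Fintype.ofFinite (P.weylGroup ⧸ descentParabolic b w)
  have hs := isFoldingSystem_simpleReflection b
  rw [integralKLSElt, finsum_eq_sum_of_fintype, map_sum, AddMonoidAlgebra.coeff_sum,
    Finsupp.finsetSum_apply, Finset.sum_eq_single (QuotientGroup.mk x⁻¹)]
  · have h1 : x * (QuotientGroup.mk x⁻¹ : P.weylGroup ⧸ descentParabolic b w).out ∈
        descentParabolic b w := by
      rw [← inv_inv x, ← QuotientGroup.eq, QuotientGroup.out_eq', inv_inv]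
    rw [weylAct_single, ← mul_smul, (smul_ascentWeight_eq_iff b hsc w _).mpr h1,
      AddMonoidAlgebra.coeff_single, Finsupp.single_eq_same,
      ← hs.klPoly_mul_of_mem_parabolic h1 x⁻¹, inv_mul_cancel_left]
  · intro q _ hq
    rw [weylAct_single, ← mul_smul, AddMonoidAlgebra.coeff_single, Finsupp.single_apply, if_neg]
    rw [smul_ascentWeight_eq_iff]
    intro h
    rw [← inv_inv x, ← QuotientGroup.eq, QuotientGroup.out_eq'] at h
    exact hq h.symm
  · simp

omit [P.IsReduced] in
theorem exists_of_coeff_weylAct_ne_zero {w x : P.weylGroup} {y : X}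
    (h : (weylAct P ℤ x (integralKLSElt b hsc w)).coeff y ≠ 0) :
    ∃ g : P.weylGroup, y = g • ascentWeight b hsc w := by
  classical
  have := finite_weylGroup hsc
  have := Fintype.ofFinite (P.weylGroup ⧸ descentParabolic b w)
  rw [integralKLSElt, finsum_eq_sum_of_fintype, map_sum, AddMonoidAlgebra.coeff_sum,
    Finsupp.finsetSum_apply] at h
  obtain ⟨q, -, hq⟩ := Finset.exists_ne_zero_of_sum_ne_zero h
  rw [weylAct_single, ← mul_smul, AddMonoidAlgebra.coeff_single, Finsupp.single_apply] at hq
  split_ifs at hq with h0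
  · exact ⟨_, h0.symm⟩
  · exact absurd rfl hq

theorem expo_neg_mul_mem_negSubring (w x : P.weylGroup) :
    expo (-ascentWeight b hsc w) * weylAct P ℤ x (integralKLSElt b hsc w) ∈
      negSubring (heightFunctional b) := by
  intro y hy
  rw [AddMonoidAlgebra.coeff_single_mul_apply, one_mul, neg_neg] at hy
  obtain ⟨g, hg⟩ := exists_of_coeff_weylAct_ne_zero b hsc hy
  obtain ⟨h1, h2⟩ := (isDominant_weightSum b hsc _).height_smul_le g
    (x := ascentWeight b hsc w)
  rw [← hg, map_add] at h1 h2
  rcases h1.lt_or_eq with h | h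
  · right
    omega
  · left
    have := h2 h
    rwa [add_eq_left] at this

variable [Fintype P.weylGroup] [DecidableEq P.weylGroup]

theorem det_orbitMatrix_mem_negSubring :
    (∏ w, expo (-ascentWeight b hsc w)) * (orbitMatrix P (integralKLSElt b hsc)).det ∈
        negSubring (heightFunctional b) ∧
      ∃ ε : ℤˣ, ((∏ w, expo (-ascentWeight b hsc w)) *
        (orbitMatrix P (integralKLSElt b hsc)).det).coeff 0 = ε := by
  have hs := isFoldingSystem_simpleReflection b
  rw [← Matrix.det_mul_row]
  obtain ⟨h1, h2⟩ := det_mem_negSubring (h := heightFunctional b)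
    (Matrix.of fun x w => expo (-ascentWeight b hsc w) *
      orbitMatrix P (integralKLSElt b hsc) x w) (fun x w => expo_neg_mul_mem_negSubring b hsc w x)
  -- The sign comes from x ↦ x⁻¹ on the rows, which turns the constant-term matrix into the
  -- unitriangular (P_{y,w}(1)).
  refine ⟨h1, Equiv.Perm.sign (Equiv.inv P.weylGroup), ?_⟩
  rw [h2]
  have h3 : (Matrix.of fun y w => (klPoly (simpleReflection b) w y).eval 1).det = 1 := by
    refine det_eq_one_of_unitriangular (length (simpleReflection b)) _ (fun w => ?_)
      fun y w hyw hl => ?_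
    · rw [Matrix.of_apply, hs.klPoly_self, Polynomial.eval_one]
    · rw [Matrix.of_apply, hs.klPoly_eq_zero hyw hl, Polynomial.eval_zero]
  rw [← mul_one ((Equiv.Perm.sign (Equiv.inv P.weylGroup) : ℤˣ) : ℤ), ← h3]
  have h4 := Matrix.det_permute (Equiv.inv P.weylGroup)
    (Matrix.of fun y w => (klPoly (simpleReflection b) w y).eval 1)
  rw [Int.cast_id] at h4
  rw [← h4]
  congr 1
  ext x w
  simp only [Matrix.of_apply, Matrix.submatrix_apply, orbitMatrix, Equiv.inv_apply, id]
  rw [AddMonoidAlgebra.coeff_single_mul_apply, one_mul, neg_neg, add_zero,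
    coeff_weylAct_integralKLSElt]

end Integrality

end KLSteinberg

end

noncomputable section

namespace KLSteinberg

open KazhdanLusztig

variable {ι X Y : Type*} [AddCommGroup X] [AddCommGroup Y] {P : RootPairing ι ℤ X Y}

/-! ### Bases from orbit matrices -/

section OrbitBasis

variable [Fintype P.weylGroup] [DecidableEq P.weylGroup] [IsDomain (AddMonoidAlgebra ℤ X)]

omit [DecidableEq P.weylGroup] [IsDomain (AddMonoidAlgebra ℤ X)] in
theorem orbitMatrix_mulVec_eq_iff (g : P.weylGroup → AddMonoidAlgebra ℤ X)
    (a : P.weylGroup → invariants P) (f : AddMonoidAlgebra ℤ X) :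
    (orbitMatrix P g).mulVec (fun w => (a w : AddMonoidAlgebra ℤ X)) =
      (fun x => weylAct P ℤ x f) ↔ ∑ w, a w • g w = f := by
  have h (x : P.weylGroup) : (orbitMatrix P g).mulVec (fun w => (a w : AddMonoidAlgebra ℤ X)) x =
      weylAct P ℤ x (∑ w, a w • g w) := by
    rw [Matrix.mulVec, dotProduct, map_sum]
    refine Finset.sum_congr rfl fun w _ => ?_
    rw [Subring.smul_def, smul_eq_mul, map_mul, (a w).2 x, mul_comm, orbitMatrix, Matrix.of_apply]
  refine ⟨fun h0 => ?_, fun h0 => funext fun x => by rw [h, h0]⟩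
  have := congrFun h0 1
  rwa [h, weylAct_one_apply, weylAct_one_apply] at this

/-- Each numerator in Cramer's rule is again an orbit determinant, namely that of the family with
g_w replaced by f. -/
theorem exists_coeff_of_dvd_det {g : P.weylGroup → AddMonoidAlgebra ℤ X}
    (h0 : (orbitMatrix P g).det ≠ 0)
    (hdvd : ∀ g' : P.weylGroup → AddMonoidAlgebra ℤ X,
      (orbitMatrix P g).det ∣ (orbitMatrix P g').det) (f : AddMonoidAlgebra ℤ X) :
    ∃ a : P.weylGroup → AddMonoidAlgebra ℤ X,
      (orbitMatrix P g).mulVec a = fun x => weylAct P ℤ x f := by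
  have h1 (w : P.weylGroup) : (orbitMatrix P g).det ∣
      (orbitMatrix P g).cramer (fun x => weylAct P ℤ x f) w := by
    rw [Matrix.cramer_apply]
    convert hdvd (Function.update g w f) using 2
    ext1 x w'
    rw [Matrix.updateCol_apply, orbitMatrix, orbitMatrix, Matrix.of_apply, Matrix.of_apply,
      Function.update_apply]
    split_ifs <;> rfl
  choose a ha using h1
  refine ⟨a, ?_⟩
  have h2 : (orbitMatrix P g).cramer (fun x => weylAct P ℤ x f) = (orbitMatrix P g).det • a :=
    funext ha
  have h3 := Matrix.mulVec_cramer (orbitMatrix P g) (fun x => weylAct P ℤ x f)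
  rw [h2, Matrix.mulVec_smul] at h3
  exact smul_right_injective _ h0 h3

/-- Applying z only permutes the equations of the system, so z a is another solution, and the
solution is unique. -/
theorem weylAct_eq_of_mulVec_eq {g : P.weylGroup → AddMonoidAlgebra ℤ X}
    (h0 : (orbitMatrix P g).det ≠ 0) {f : AddMonoidAlgebra ℤ X}
    {a : P.weylGroup → AddMonoidAlgebra ℤ X}
    (ha : (orbitMatrix P g).mulVec a = fun x => weylAct P ℤ x f) (z w : P.weylGroup) :
    weylAct P ℤ z (a w) = a w := by
  have h1 : (orbitMatrix P g).mulVec (fun w => weylAct P ℤ z (a w)) =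
      (orbitMatrix P g).mulVec a := by
    rw [ha]
    funext x
    have := congrArg (weylAct P ℤ z) (congrFun ha (z⁻¹ * x))
    rw [← weylAct_mul_apply, mul_inv_cancel_left] at this
    rw [← this, Matrix.mulVec, Matrix.mulVec, dotProduct, dotProduct, map_sum]
    refine Finset.sum_congr rfl fun w _ => ?_
    rw [map_mul, orbitMatrix, Matrix.of_apply, Matrix.of_apply, ← weylAct_mul_apply,
      mul_inv_cancel_left]
  rw [← sub_eq_zero, ← Matrix.mulVec_sub] at h1
  exact sub_eq_zero.mp (congrFun (Matrix.eq_zero_of_mulVec_eq_zero h0 h1) w)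

/-- A family whose orbit matrix has a determinant dividing all others is a basis. -/
theorem exists_basis_of_dvd_det {g : P.weylGroup → AddMonoidAlgebra ℤ X}
    (h0 : (orbitMatrix P g).det ≠ 0)
    (hdvd : ∀ g' : P.weylGroup → AddMonoidAlgebra ℤ X,
      (orbitMatrix P g).det ∣ (orbitMatrix P g').det) :
    ∃ f : Module.Basis P.weylGroup (invariants P) (AddMonoidAlgebra ℤ X), ∀ w, f w = g w := by
  have hli : LinearIndependent (invariants P) g := by
    rw [Fintype.linearIndependent_iff]
    intro a ha w
    rw [← orbitMatrix_mulVec_eq_iff] at ha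
    have h1 := Matrix.eq_zero_of_mulVec_eq_zero h0 (ha.trans (funext fun x => map_zero _))
    exact Subtype.ext (congrFun h1 w)
  have hsp : ⊤ ≤ Submodule.span (invariants P) (Set.range g) := by
    intro f _
    obtain ⟨a, ha⟩ := exists_coeff_of_dvd_det h0 hdvd f
    rw [Submodule.mem_span_range_iff_exists_fun]
    exact ⟨fun w => ⟨a w, fun z => weylAct_eq_of_mulVec_eq h0 ha z w⟩,
      (orbitMatrix_mulVec_eq_iff g _ f).mp ha⟩
  exact ⟨Module.Basis.mk hli hsp, fun w => Module.Basis.mk_apply hli hsp w⟩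

end OrbitBasis

/-! ### The determinant of the Kazhdan–Lusztig–Steinberg elements -/

section Determinant

variable (b : P.Base) [Finite ι] [P.IsReduced]

theorem weylDenominator_mem_negSubring :
    weylDenominator b ∈ negSubring (heightFunctional b) ∧ (weylDenominator b).coeff 0 = 1 := by
  classical
  let := Fintype.ofFinite ι
  have h0 : weylDenominator b = ∏ i with b.IsPos i, (1 - expo (-P.root i)) := by
    rw [weylDenominator]
  have h1 (i : ι) (hi : b.IsPos i) : 1 - expo (-P.root i) ∈ negSubring (heightFunctional b) ∧
      (1 - expo (-P.root i) : AddMonoidAlgebra ℤ X).coeff 0 = 1 := by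
    constructor
    · refine sub_mem (one_mem _) (single_mem_negSubring (Or.inr ?_) 1)
      rw [map_neg, heightFunctional_root]
      have : 0 < b.height i := hi
      omega
    · rw [AddMonoidAlgebra.coeff_sub, Finsupp.sub_apply, AddMonoidAlgebra.coeff_one_zero,
        AddMonoidAlgebra.coeff_single, Finsupp.single_eq_of_ne, sub_zero]
      exact (neg_ne_zero.mpr (P.ne_zero i)).symm
  rw [h0]
  refine Finset.prod_induction _ (fun f => f ∈ negSubring (heightFunctional b) ∧ f.coeff 0 = 1)
    ?_ ⟨one_mem _, AddMonoidAlgebra.coeff_one_zero⟩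
    fun i hi => h1 i (Finset.mem_filter.mp hi).2
  rintro f g ⟨hf, hf1⟩ ⟨hg, hg1⟩
  refine ⟨mul_mem hf hg, ?_⟩
  have := (constCoeff (heightFunctional b)).map_mul ⟨f, hf⟩ ⟨g, hg⟩
  change _ = f.coeff 0 * g.coeff 0 at this
  rwa [hf1, hg1] at this

theorem weylDenominator_pow_mem_negSubring (m : ℕ) :
    weylDenominator b ^ m ∈ negSubring (heightFunctional b) ∧
      (weylDenominator b ^ m).coeff 0 = 1 := by
  obtain ⟨h1, h2⟩ := weylDenominator_mem_negSubring b
  refine ⟨pow_mem h1 m, ?_⟩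
  have := (constCoeff (heightFunctional b)).map_pow ⟨_, h1⟩ m
  change _ = (weylDenominator b).coeff 0 ^ m at this
  rwa [h2, one_pow] at this

variable (hsc : P.corootSpan ℤ = ⊤) [Fintype P.weylGroup] [DecidableEq P.weylGroup]

-- The involution w ↦ w s_i exchanges ascents and descents at i, so α_i^∨ pairs to 1 with exactly
-- half of the summands.
omit [DecidableEq P.weylGroup] in
theorem simpleReflection_smul_sum_ascentWeight (i : b.support) :
    simpleReflection b i • ∑ w, ascentWeight b hsc w =
      ∑ w, ascentWeight b hsc w - (Fintype.card P.weylGroup / 2) • P.root i := by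
  classical
  have h1 : P.toLinearMap (∑ w, ascentWeight b hsc w) (P.coroot i) =
      ((Fintype.card P.weylGroup / 2 : ℕ) : ℤ) := by
    rw [map_sum, LinearMap.sum_apply]
    have h2 (w : P.weylGroup) : P.toLinearMap (ascentWeight b hsc w) (P.coroot i) =
        if b.IsPos (w • (i : ι)) then 1 else 0 := by
      rw [ascentWeight, weightSum_coroot]
      simp only [Set.mem_compl_iff, mem_rightDescents_iff, not_not]
    simp only [h2]
    rw [Finset.sum_boole, ← Fintype.card_subtype]
    have h3 (w : P.weylGroup) : ¬ b.IsPos ((w * simpleReflection b i) • (i : ι)) ↔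
        ¬ ¬ b.IsPos (w • (i : ι)) := by
      rw [not_iff_not, ← isPos_reflectionPerm_self_iff, ← ofIdx_smul_idx, ← mul_smul, ofIdx_smul]
      rfl
    have h4 := two_mul_card_of_involution (fun w => w * simpleReflection b i)
      (fun w => by rw [mul_assoc, simpleReflection_mul_self, mul_one])
      (fun w => ¬ b.IsPos (w • (i : ι))) h3
    simp only [not_not] at h4
    congr 1
    omega
  rw [simpleReflection_smul_weight, h1, natCast_zsmul]

omit [DecidableEq P.weylGroup] in
include hsc in
/-- The support of a Weyl-stable element without terms of positive height is `{0}`. -/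
theorem eq_zero_of_coeff_ne_zero {f : AddMonoidAlgebra ℤ X}
    (hf : f ∈ negSubring (heightFunctional b))
    (hs : ∀ (i : b.support) x, f.coeff x ≠ 0 → f.coeff (simpleReflection b i • x) ≠ 0) {x : X}
    (hx : f.coeff x ≠ 0) : x = 0 := by
  have h1 (g : P.weylGroup) : f.coeff (g • x) ≠ 0 := by
    have hg : g ∈ Subgroup.closure (Set.range (simpleReflection b)) := by
      rw [closure_range_simpleReflection]; trivial
    induction hg using Subgroup.closure_induction_left with
    | one => rwa [one_smul]
    | mul_left s hs' y _ ih =>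
      obtain ⟨i, rfl⟩ := hs'
      rw [mul_smul]
      exact hs i _ ih
    | inv_mul_cancel s hs' y _ ih =>
      obtain ⟨i, rfl⟩ := hs'
      rw [inv_eq_of_mul_eq_one_left (simpleReflection_mul_self b i), mul_smul]
      exact hs i _ ih
  -- A W-fixed weight is zero. So the heights along the orbit of x, all nonpositive, sum to 0 and
  -- each of them vanishes.
  have h2 : ∑ g : P.weylGroup, g • x = 0 := by
    refine eq_zero_of_forall_smul_eq hsc fun g => ?_
    rw [Finset.smul_sum]
    exact Fintype.sum_equiv (Equiv.mulLeft g) _ _ fun y => by simp [mul_smul]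
  have h3 : ∑ g : P.weylGroup, heightFunctional b (g • x) = 0 := by rw [← map_sum, h2, map_zero]
  have h4 := (Finset.sum_eq_zero_iff_of_nonpos fun g _ =>
    height_nonpos_of_mem_negSubring hf _ (h1 g)).mp h3 1 (Finset.mem_univ _)
  rw [one_smul] at h4
  exact (hf x hx).resolve_right h4.not_lt

theorem exists_det_orbitMatrix_eq [IsDomain (AddMonoidAlgebra ℤ X)] :
    ∃ ε : ℤˣ, (orbitMatrix P (integralKLSElt b hsc)).det =
      expo (∑ w, ascentWeight b hsc w) * weylDenominator b ^ (Fintype.card P.weylGroup / 2) *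
        AddMonoidAlgebra.single 0 (ε : ℤ) := by
  classical
  obtain ⟨hD, hD1⟩ := weylDenominator_pow_mem_negSubring b (Fintype.card P.weylGroup / 2)
  have hD0 : weylDenominator b ^ (Fintype.card P.weylGroup / 2) ≠ 0 := by
    intro h
    rw [h] at hD1
    exact zero_ne_one hD1
  obtain ⟨Q, hQ⟩ := weylDenominator_pow_dvd_det b (integralKLSElt b hsc)
  obtain ⟨h1, ε, hε⟩ := det_orbitMatrix_mem_negSubring b hsc
  have hμ : ∏ w, expo (-ascentWeight b hsc w) = expo (-∑ w, ascentWeight b hsc w) := by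
    rw [← Finset.sum_neg_distrib]
    exact (map_prod (AddMonoidAlgebra.of ℤ X) (fun w => .ofAdd (-ascentWeight b hsc w)) _).symm
  have hε0 : (ε : ℤ) ≠ 0 := ε.ne_zero
  rw [hμ, hQ, mul_left_comm] at h1 hε
  obtain ⟨h2, h3⟩ := mem_negSubring_of_mul_mem hD hD1 h1 (by rw [hε]; exact hε0)
  -- The factor exp(m α_i), m = |W|/2, from s_i acting on D^m cancels the shift of exp(-μ); only
  -- signs remain.
  have hsym (i : b.support) : weylAct P ℤ (simpleReflection b i)
      (expo (-∑ w, ascentWeight b hsc w) * Q) = expo (-∑ w, ascentWeight b hsc w) * Q ∨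
      weylAct P ℤ (simpleReflection b i)
      (expo (-∑ w, ascentWeight b hsc w) * Q) = -(expo (-∑ w, ascentWeight b hsc w) * Q) := by
    obtain ⟨ε', hε'⟩ := weylAct_det (simpleReflection b i) (integralKLSElt b hsc)
    rw [hQ, map_mul, map_pow, weylAct_simple_weylDenominator, mul_pow, neg_pow, mul_left_comm,
      mul_comm _ (weylDenominator b ^ _), mul_assoc] at hε'
    have h4 := mul_left_cancel₀ hD0 hε'
    rw [map_mul, weylAct_single, smul_neg, simpleReflection_smul_sum_ascentWeight, neg_sub',
      sub_neg_eq_add, ← expo, expo_add, expo_nsmul]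
    rcases neg_one_pow_eq_or (AddMonoidAlgebra ℤ X) (Fintype.card P.weylGroup / 2) with h5 | h5 <;>
    rcases Int.units_eq_one_or ε' with h6 | h6 <;> rw [h5, h6] at h4 <;>
    simp only [one_mul, Units.val_one, Int.cast_one, Units.val_neg, Int.cast_neg, neg_mul] at h4
    · left; rw [mul_assoc, h4]
    · right; rw [mul_assoc, h4, mul_neg]
    · right; rw [mul_assoc, ← neg_eq_iff_eq_neg.mpr h4.symm, mul_neg]
    · left; rw [mul_assoc, neg_inj.mp h4]
  have hstable : ∀ (i : b.support) x, (expo (-∑ w, ascentWeight b hsc w) * Q).coeff x ≠ 0 →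
      (expo (-∑ w, ascentWeight b hsc w) * Q).coeff (simpleReflection b i • x) ≠ 0 := by
    intro i x hx h0
    rw [← coeff_weylAct_smul P (simpleReflection b i)] at hx
    rcases hsym i with h | h <;> rw [h] at hx
    · exact hx h0
    · rw [AddMonoidAlgebra.coeff_neg, Finsupp.neg_apply, h0, neg_zero] at hx
      exact hx rfl
  have h4 : expo (-∑ w, ascentWeight b hsc w) * Q = AddMonoidAlgebra.single 0 (ε : ℤ) := by
    ext x
    rw [AddMonoidAlgebra.coeff_single, Finsupp.single_apply]
    split_ifs with h0
    · rw [← h0, h3, hε]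
    · by_contra h5
      exact h0 (eq_zero_of_coeff_ne_zero b hsc h2 hstable h5).symm
  refine ⟨ε, ?_⟩
  rw [hQ, ← h4, mul_comm (expo _), mul_assoc, ← mul_assoc (expo _), expo_mul_expo_neg, one_mul]

theorem det_orbitMatrix_ne_zero_and_dvd [IsDomain (AddMonoidAlgebra ℤ X)] :
    (orbitMatrix P (integralKLSElt b hsc)).det ≠ 0 ∧
      ∀ g : P.weylGroup → AddMonoidAlgebra ℤ X,
        (orbitMatrix P (integralKLSElt b hsc)).det ∣ (orbitMatrix P g).det := by
  obtain ⟨ε, hε⟩ := exists_det_orbitMatrix_eq b hsc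
  have hu : IsUnit (expo (∑ w, ascentWeight b hsc w)) := .of_mul_eq_one _ (expo_mul_expo_neg _)
  have hv : IsUnit (AddMonoidAlgebra.single (0 : X) (ε : ℤ)) :=
    ε.isUnit.map AddMonoidAlgebra.singleZeroRingHom
  constructor
  · rw [hε]
    refine mul_ne_zero (mul_ne_zero hu.ne_zero fun h => ?_) hv.ne_zero
    have := (weylDenominator_pow_mem_negSubring b (Fintype.card P.weylGroup / 2)).2
    rw [h] at this
    exact zero_ne_one this
  · intro g
    rw [hε, hv.mul_right_dvd, hu.mul_left_dvd]
    exact weylDenominator_pow_dvd_det b g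

end Determinant

end KLSteinberg

end

theorem mainTheorem2 {ι X Y : Type*} [Finite ι] [AddCommGroup X] [AddCommGroup Y]
    [Module.Finite ℤ X] [Module.Finite ℤ Y]
    (P : RootPairing ι ℤ X Y) [P.IsReduced] (b : P.Base) (hsc : P.corootSpan ℤ = ⊤) :
    ∃ f : Module.Basis P.weylGroup (KLSteinberg.invariants P) (AddMonoidAlgebra ℤ X),
      ∀ w : P.weylGroup,
        AddMonoidAlgebra.mapRingHom X (Int.castRingHom ℂ) (f w) =
          KLSteinberg.klsElt b hsc w := by
  classical
  have := KLSteinberg.finite_weylGroup hsc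
  have := Fintype.ofFinite P.weylGroup
  have := KLSteinberg.isAddTorsionFree_weight P
  have := KLSteinberg.isDomain_groupRing (X := X)
  obtain ⟨h0, hdvd⟩ := KLSteinberg.det_orbitMatrix_ne_zero_and_dvd b hsc
  obtain ⟨f, hf⟩ := KLSteinberg.exists_basis_of_dvd_det h0 hdvd
  exact ⟨f, fun w => by rw [hf, KLSteinberg.mapRingHom_integralKLSElt]⟩
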